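/- Let $N\ge 1$ be an integer. Let $U_n$ be the Chebyshev polynomial of the second kind, $U_n(\cos t)=\sin((n+1)t)/\sin t$, let $I$ be the $N\times N$ unit matrix, and let $A$ and $B$ be the symmetric $N\times N$ matrices with $A_{ij}=\tfrac12$ if $|i-j|=1$, $B_{ij}=\tfrac12$ if $|i-j|=2$, and all other entries $0$. A principal vector of the pencil $I+A-c(I-B)$ is a vector $Z\neq 0$ with $(I+A)Z=c(I-B)Z$. Consider the extremal problem $$\hat J_N=\max\Big\{\sum_{j=1}^N\alpha_j:\ \alpha_1=1,\ \sum_{j=1}^N\alpha_j\sin jt\ge 0\ \text{ for all } t\in[0,\pi]\Big\},\qquad \alpha_j\in\mathbb R, \tag{$*$}$$ whose extremal polynomials are the polynomials $\sum_{j=1}^N\alpha_jz^j$ with coefficients attaining the maximum. (i) If $N$ is odd, then $\mu=\sin\frac{\pi}{2(N+2)}$ is the least positive root of $U_{N+1}$, and the numbers $$z_k^{(0)}=(-1)^{k-1}\Big(U_{k-1}(\mu)U_k(\mu)+U_{N-k}(\mu)U_{N-k+1}(\mu)+\tfrac{N+1-2k}{N+1}U_N(\mu)U_{N+1}(\mu)\Big),\quad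 k=1,\dots,N,$$ are the coordinates of a principal vector of $I+A-\frac1{4\mu^2}(I-B)$. (ii) If $N\ge 2$, then $U'_{N+1}$ has a least positive root $\nu$, and the numbers $$z_k^{(1)}=(-1)^{k-1}\Big(U_{k-1}(\nu)U_k(\nu)-U_{N-k}(\nu)U_{N-k+1}(\nu)+\tfrac{N+1-2k}{N+1}U_N(\nu)U_{N+1}(\nu)\Big),\quad k=1,\dots,N,$$ are the coordinates of a principal vector of $I+A-\frac1{4\nu^2}(I-B)$. (iii) Put $s=0$ if $N$ is odd and $s=1$ if $N$ is even. Then $D=\sum_{j=1}^{N}z_j^{(s)}z_j^{(s)}-\sum_{j=1}^{N-2}z_j^{(s)}z_{j+2}^{(s)}>0$, problem $(*)$ has exactly one extremal polynomial, and its coefficients are $$\alpha_k=\frac1D\Big(\sum_{j=1}^{N-k+1}z_j^{(s)}z_{j+k-1}^{(s)}-\sum_{j=1}^{N-k-1}z_j^{(s)}z_{j+k+1}^{(s)}\Big),\quad k=1,\dots,N-2,$$ $$\alpha_{N-1}=\frac{z_1^{(s)}z_{N-1}^{(s)}+z_2^{(s)}z_N^{(s)}}{D}\quad(N\ge 2),\qquad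 \alpha_N=\frac{z_1^{(s)}z_N^{(s)}}{D}.$$ -/

import Mathlib

open Polynomial

/-- The symmetric `N × N` matrix with `1/2` on the first sub- and superdiagonal, `0` elsewhere. -/
noncomputable def matA (N : ℕ) : Matrix (Fin N) (Fin N) ℝ :=
  Matrix.of fun i j => if (i : ℕ) + 1 = j ∨ (j : ℕ) + 1 = i then 1 / 2 else 0

/-- The symmetric `N × N` matrix with `1/2` on the second sub- and superdiagonal, `0` elsewhere. -/
noncomputable def matB (N : ℕ) : Matrix (Fin N) (Fin N) ℝ :=
  Matrix.of fun i j => if (i : ℕ) + 2 = j ∨ (j : ℕ) + 2 = i then 1 / 2 else 0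

/-- `z 1, …, z N` are the coordinates of a principal vector (generalized eigenvector) of the
pencil `I + A - c (I - B)`, with characteristic number `c`. -/
def IsPrincipalVector (N : ℕ) (c : ℝ) (z : ℕ → ℝ) : Prop :=
  (fun i : Fin N => z ((i : ℕ) + 1)) ≠ 0 ∧
    (1 + matA N).mulVec (fun i : Fin N => z ((i : ℕ) + 1)) =
      c • (1 - matB N).mulVec (fun i : Fin N => z ((i : ℕ) + 1))

/-- The value at `x` of the Chebyshev polynomial of the second kind of degree `n`. -/
noncomputable def chebU (n : ℤ) (x : ℝ) : ℝ := (Chebyshev.U ℝ n).eval x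

/-- The coordinate `z_k^{(0)}` (`1 ≤ k ≤ N`) as a function of the evaluation point `x`. -/
noncomputable def zMu (N : ℕ) (x : ℝ) (k : ℕ) : ℝ :=
  (-1) ^ (k - 1) * (chebU (k - 1) x * chebU k x + chebU (N - k) x * chebU (N - k + 1) x
    + ((N : ℝ) + 1 - 2 * k) / ((N : ℝ) + 1) * (chebU N x * chebU (N + 1) x))

/-- The coordinate `z_k^{(1)}` (`1 ≤ k ≤ N`) as a function of the evaluation point `x`. -/
noncomputable def zNu (N : ℕ) (x : ℝ) (k : ℕ) : ℝ :=
  (-1) ^ (k - 1) * (chebU (k - 1) x * chebU k x - chebU (N - k) x * chebU (N - k + 1) x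
    + ((N : ℝ) + 1 - 2 * k) / ((N : ℝ) + 1) * (chebU N x * chebU (N + 1) x))

/-- `F = ∑_{j=1}^N α_j z^j` with `α_1 = 1` and `∑ α_j sin (j t) ≥ 0` on `[0, π]`. -/
def IsAdmissible (N : ℕ) (F : ℝ[X]) : Prop :=
  F.natDegree ≤ N ∧ F.coeff 0 = 0 ∧ F.coeff 1 = 1 ∧
    ∀ t ∈ Set.Icc (0 : ℝ) Real.pi, 0 ≤ ∑ j ∈ Finset.Icc 1 N, F.coeff j * Real.sin (j * t)

/-- `F` is an extremal polynomial of the auxiliary problem: it is admissible and it maximizes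
`∑_{j=1}^N α_j` among the admissible polynomials. -/
def IsExtremal (N : ℕ) (F : ℝ[X]) : Prop :=
  IsAdmissible N F ∧ ∀ G : ℝ[X], IsAdmissible N G →
    ∑ j ∈ Finset.Icc 1 N, G.coeff j ≤ ∑ j ∈ Finset.Icc 1 N, F.coeff j

/-- The common denominator `∑_{j=1}^N z_j z_j - ∑_{j=1}^{N-2} z_j z_{j+2}`. -/
noncomputable def denom (N : ℕ) (z : ℕ → ℝ) : ℝ :=
  ∑ j ∈ Finset.Icc 1 N, z j * z j - ∑ j ∈ Finset.Icc 1 (N - 2), z j * z (j + 2)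

/-- The coefficients of `F` are the stated quadratic expressions in `z 1, …, z N`
(for `N = 1` there is no coefficient with index `N - 1`). -/
def CoeffsGivenBy (N : ℕ) (z : ℕ → ℝ) (F : ℝ[X]) : Prop :=
  (∀ k : ℕ, 1 ≤ k → k + 2 ≤ N → F.coeff k =
    (∑ j ∈ Finset.Icc 1 (N - k + 1), z j * z (j + k - 1)
      - ∑ j ∈ Finset.Icc 1 (N - k - 1), z j * z (j + k + 1)) / denom N z) ∧
  (2 ≤ N → F.coeff (N - 1) = (z 1 * z (N - 1) + z 2 * z N) / denom N z) ∧
  F.coeff N = z 1 * z N / denom N z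

/-! The sine sum of an admissible polynomial is `sin t · p(cos t)` with `p ≥ 0` on `[-1, 1]`, and
such a `p(cos t)` is a finite sum of squares `|P(e^{it})|²` with real coefficients
(`isTrigSOS_eval_cos`). If `P` has coefficient vector `v` with autocorrelations `r_m = ∑ v_j
v_{j+m}`, then the `k`-th sine coefficient of `sin t · |P|²` is `r_{k-1} - r_{k+1}`. Hence `α_1` is
the sum over the squares of `r_0 - r_2`, the form of `I - B`, and `∑ α_k` telescopes to that of `r_0
+ r_1`, the form of `I + A`. Under `α_1 = 1`, the gap `c - ∑ α_k` is a sum of values of the form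
`c(I - B) - (I + A)` (`pencil_quadratic_form`).

For `c > 0` this matrix has nonpositive off-diagonal entries. If it annihilates a vector `z` with
coordinates of one sign, the ground state representation writes the form as a nonnegative
combination of `(v_i/z_i - v_j/z_j)²`. So it is positive semidefinite, and since the entries next to
the diagonal do not vanish, its kernel is spanned by `z`. The maximum is therefore `c`, attained
only by the sine coefficients built from `z` (`extremal_of_principal_vector`).

It remains to find `z`. The products `U_{k-1} U_k`, their reflections under `k ↦ N + 1 - k` and
functions affine in `k` all satisfy one five-term recurrence, which becomes the pencil equation
after multiplication by `(-1)^{k-1}`. The root conditions on `μ` and `ν` give zeros at `k = -1, 0, N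
+ 1, N + 2`, so the boundary rows hold too. The substitution `x = sin ψ` gives closed forms in which
the common sign of the coordinates is visible. -/

/-! ### Nonnegative polynomials in `cos t` as sums of squared moduli -/

/-- `g` is a finite sum of squared moduli `|P (e^{it})|²` of real polynomials of degree at most
`n`. -/
def IsTrigSOS (n : ℕ) (g : ℝ → ℝ) : Prop :=
  ∃ (ι : Type) (_ : Fintype ι) (P : ι → ℝ[X]), (∀ i, (P i).natDegree ≤ n) ∧
    ∀ t : ℝ, g t = ∑ i, Complex.normSq (aeval (Complex.exp (t * Complex.I)) (P i))

namespace IsTrigSOS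

theorem of_poly {n : ℕ} (P : ℝ[X]) (hP : P.natDegree ≤ n) :
    IsTrigSOS n fun t => Complex.normSq (aeval (Complex.exp (t * Complex.I)) P) :=
  ⟨Unit, inferInstance, fun _ => P, fun _ => hP, fun t => by simp⟩

theorem const {n : ℕ} {c : ℝ} (hc : 0 ≤ c) : IsTrigSOS n fun _ => c := by
  refine ⟨Unit, inferInstance, fun _ => C (√c), fun _ => by simp, fun t => ?_⟩
  simp [Complex.normSq_ofReal, Real.mul_self_sqrt hc]

theorem add {n : ℕ} {f g : ℝ → ℝ} (hf : IsTrigSOS n f) (hg : IsTrigSOS n g) :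
    IsTrigSOS n fun t => f t + g t := by
  obtain ⟨ι, _, P, hP, hfP⟩ := hf
  obtain ⟨κ, _, Q, hQ, hgQ⟩ := hg
  refine ⟨ι ⊕ κ, inferInstance, Sum.elim P Q, ?_, fun t => ?_⟩
  · rintro (i | i)
    · exact hP i
    · exact hQ i
  · simp [hfP t, hgQ t]

theorem mul {m n : ℕ} {f g : ℝ → ℝ} (hf : IsTrigSOS m f) (hg : IsTrigSOS n g) :
    IsTrigSOS (m + n) fun t => f t * g t := by
  obtain ⟨ι, _, P, hP, hfP⟩ := hf
  obtain ⟨κ, _, Q, hQ, hgQ⟩ := hg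
  refine ⟨ι × κ, inferInstance, fun x => P x.1 * Q x.2, fun x => ?_, fun t => ?_⟩
  · exact natDegree_mul_le.trans (add_le_add (hP _) (hQ _))
  · simp [hfP t, hgQ t, Fintype.sum_prod_type, Finset.sum_mul_sum]

theorem mono {m n : ℕ} (hmn : m ≤ n) {f : ℝ → ℝ} (hf : IsTrigSOS m f) : IsTrigSOS n f := by
  obtain ⟨ι, _, P, hP, hfP⟩ := hf
  exact ⟨ι, _, P, fun i => (hP i).trans hmn, hfP⟩

theorem congr {n : ℕ} {f g : ℝ → ℝ} (hf : IsTrigSOS n f) (h : ∀ t, f t = g t) : IsTrigSOS n g :=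
  (funext h : f = g) ▸ hf

/-- `a - cos t = (a - 1) + ½ |e^{it} - 1|²`; `add_cos` is the analogue with `e^{it} + 1`. -/
theorem sub_cos {a : ℝ} (ha : 1 ≤ a) : IsTrigSOS 1 fun t => a - Real.cos t := by
  have h := ((const (n := 0) (c := 1 / 2) (by norm_num)).mul
    (of_poly (n := 1) (X - C 1) (natDegree_X_sub_C 1).le)).add
    (const (n := 0 + 1) (c := a - 1) (by linarith))
  refine h.congr fun t => ?_
  simp only [map_sub, aeval_X, Complex.normSq_apply, Complex.sub_re, Complex.sub_im,
    Complex.exp_ofReal_mul_I_re, Complex.exp_ofReal_mul_I_im, map_one, Complex.one_re,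
    Complex.one_im]
  nlinarith [Real.sin_sq_add_cos_sq t]

theorem add_cos {a : ℝ} (ha : 1 ≤ a) : IsTrigSOS 1 fun t => a + Real.cos t := by
  have h := ((const (n := 0) (c := 1 / 2) (by norm_num)).mul
    (of_poly (n := 1) (X + C 1) (natDegree_X_add_C 1).le)).add
    (const (n := 0 + 1) (c := a - 1) (by linarith))
  refine h.congr fun t => ?_
  simp only [map_add, aeval_X, Complex.normSq_apply, Complex.add_re, Complex.add_im,
    Complex.exp_ofReal_mul_I_re, Complex.exp_ofReal_mul_I_im, map_one, Complex.one_re,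
    Complex.one_im]
  nlinarith [Real.sin_sq_add_cos_sq t]

/-- `|e^{2it} - 2a e^{it} + 1|² = 4 (cos t - a)²`, because the polynomial is palindromic. -/
theorem cos_sub_sq (a : ℝ) {b : ℝ} (hb : 0 ≤ b) :
    IsTrigSOS 2 fun t => (Real.cos t - a) ^ 2 + b := by
  have hd : (X ^ 2 - C (2 * a) * X + C 1 : ℝ[X]).natDegree ≤ 2 := by compute_degree
  have h := ((const (n := 0) (c := 1 / 4) (by norm_num)).mul
    (of_poly (n := 2) (X ^ 2 - C (2 * a) * X + C 1) hd)).add (const (n := 0 + 2) hb)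
  refine h.congr fun t => ?_
  simp only [map_add, map_sub, map_mul, aeval_X, aeval_C, Complex.normSq_apply,
    Complex.add_re, Complex.add_im, Complex.sub_re, Complex.sub_im, pow_two, Complex.mul_re,
    Complex.mul_im, Complex.exp_ofReal_mul_I_re, Complex.exp_ofReal_mul_I_im, map_one,
    Complex.one_re, Complex.one_im, Complex.coe_algebraMap, Complex.ofReal_re, Complex.ofReal_im]
  have hs : Real.sin t ^ 2 = 1 - Real.cos t ^ 2 := Real.sin_sq t
  linear_combination (a ^ 2 - a * Real.cos t + (Real.sin t ^ 2 + Real.cos t ^ 2 - 1) / 4) * hs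

end IsTrigSOS

/-- On `[-1, 1]`, a nonnegative nonzero polynomial factor can be cancelled. -/
theorem eval_nonneg_of_mul_nonneg {h q : ℝ[X]} (h0 : h ≠ 0)
    (hh : ∀ x ∈ Set.Icc (-1 : ℝ) 1, 0 ≤ h.eval x)
    (hq : ∀ x ∈ Set.Icc (-1 : ℝ) 1, 0 ≤ (h * q).eval x) :
    ∀ x ∈ Set.Icc (-1 : ℝ) 1, 0 ≤ q.eval x := by
  have hdense : Dense {x : ℝ | h.eval x ≠ 0} := by
    have hfin : ({x : ℝ | h.eval x = 0}).Finite := by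
      refine (h.roots.toFinset.finite_toSet).subset fun x hx => ?_
      simpa [h0] using hx
    exact hfin.countable.dense_compl ℝ
  have hsub : closure (Set.Ioo (-1 : ℝ) 1 ∩ {x : ℝ | h.eval x ≠ 0}) ⊆ {x | 0 ≤ q.eval x} := by
    refine closure_minimal ?_ (isClosed_le continuous_const q.continuous)
    rintro x ⟨hx, hne⟩
    have hx' := Set.Ioo_subset_Icc_self hx
    have hpos := lt_of_le_of_ne (hh x hx') (Ne.symm hne)
    have := hq x hx'
    rw [eval_mul] at this
    exact nonneg_of_mul_nonneg_right this hpos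
  intro x hx
  refine hsub (closure_minimal (hdense.open_subset_closure_inter isOpen_Ioo) isClosed_closure ?_)
  rwa [closure_Ioo (by norm_num)]

/-- Induction on the degree: a complex root yields a factor that is nonnegative on `[-1, 1]` and is
itself a sum of squares. The factor is linear for a real root outside `(-1, 1)`, a square for one
inside, and a real quadratic for a nonreal root. -/
theorem isTrigSOS_eval_cos (n : ℕ) : ∀ p : ℝ[X], p.natDegree ≤ n →
    (∀ x ∈ Set.Icc (-1 : ℝ) 1, 0 ≤ p.eval x) → IsTrigSOS n fun t => p.eval (Real.cos t) := by
  induction n using Nat.strong_induction_on with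
  | _ n ih =>
  intro p hpn hp
  rcases Nat.eq_zero_or_pos p.natDegree with hd | hd
  · rw [natDegree_eq_zero] at hd
    obtain ⟨c, rfl⟩ := hd
    have := hp 0 (by simp)
    simp only [eval_C] at this ⊢
    exact .const this
  have step : ∀ (m : ℕ) (h q : ℝ[X]), 0 < m → h.natDegree = m → p = h * q →
      (∀ x ∈ Set.Icc (-1 : ℝ) 1, 0 ≤ h.eval x) →
      IsTrigSOS m (fun t => h.eval (Real.cos t)) →
      IsTrigSOS n fun t => p.eval (Real.cos t) := by
    intro m h q hm hdeg hpq hh hS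
    have h0 : h ≠ 0 := by rintro rfl; simp at hdeg; omega
    have q0 : q ≠ 0 := by rintro rfl; simp [hpq] at hd
    have hdd : p.natDegree = m + q.natDegree := by rw [hpq, natDegree_mul h0 q0, hdeg]
    have hq := ih (n - m) (by omega) q (by omega)
      (eval_nonneg_of_mul_nonneg h0 hh (by rwa [← hpq]))
    refine ((hS.mul hq).mono (by omega)).congr fun t => ?_
    simp [hpq]
  have p0 : p ≠ 0 := by rintro rfl; simp at hd
  obtain ⟨z, hz⟩ := Complex.exists_root (f := p.map (algebraMap ℝ ℂ)) (by
    rw [degree_map]; exact natDegree_pos_iff_degree_pos.mp hd)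
  have hz' : aeval z p = 0 := by
    rwa [IsRoot, eval_map_algebraMap] at hz
  by_cases him : z.im = 0
  · obtain ⟨x, rfl⟩ : ∃ x : ℝ, z = x := ⟨z.re, by apply Complex.ext <;> simp [him]⟩
    have hx : p.IsRoot x := by
      have : aeval (algebraMap ℝ ℂ x) p = 0 := hz'
      rw [aeval_algebraMap_apply] at this
      simpa [IsRoot] using this
    obtain ⟨q, hq⟩ := dvd_iff_isRoot.mpr hx
    rcases le_or_gt 1 x with h1 | h1
    · refine step 1 (C x - X) (-q) one_pos ?_ (by rw [hq]; ring) ?_ ?_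
      · rw [← neg_sub, natDegree_neg, natDegree_X_sub_C]
      · intro y hy; simp only [eval_sub, eval_C, eval_X]; linarith [hy.2]
      · simpa using IsTrigSOS.sub_cos h1
    rcases le_or_gt x (-1) with h2 | h2
    · refine step 1 (X - C x) q one_pos (natDegree_X_sub_C x) hq ?_ ?_
      · intro y hy; simp only [eval_sub, eval_C, eval_X]; linarith [hy.1]
      · refine (IsTrigSOS.add_cos (a := -x) (by linarith)).congr fun t => ?_
        simp; ring
    -- An interior root is a local minimum, so it is at least a double root.
    have hmin : IsLocalMin (fun y => p.eval y) x := by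
      filter_upwards [Icc_mem_nhds h2 h1] with y hy
      rw [show p.eval x = 0 from hx]
      exact hp y hy
    have hder := hmin.hasDerivAt_eq_zero (p.hasDerivAt x)
    have hqx : q.IsRoot x := by
      rw [hq] at hder
      simpa [derivative_mul] using hder
    obtain ⟨r, hr⟩ := dvd_iff_isRoot.mpr hqx
    refine step 2 ((X - C x) ^ 2) r two_pos ?_ (by rw [hq, hr]; ring) ?_ ?_
    · rw [natDegree_pow, natDegree_X_sub_C]
    · intro y hy; simp only [eval_pow, eval_sub, eval_C, eval_X]; positivity
    · simpa using IsTrigSOS.cos_sub_sq x le_rfl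
  · obtain ⟨q, hq⟩ := p.quadratic_dvd_of_aeval_eq_zero_im_ne_zero hz' him
    have hnorm : ‖z‖ ^ 2 = z.re ^ 2 + z.im ^ 2 := by
      rw [← Complex.normSq_eq_norm_sq, Complex.normSq_apply]; ring
    have hev : ∀ y, (X ^ 2 - C (2 * z.re) * X + C (‖z‖ ^ 2) : ℝ[X]).eval y
        = (y - z.re) ^ 2 + z.im ^ 2 := by
      intro y
      simp only [eval_add, eval_sub, eval_mul, eval_pow, eval_X, eval_C, hnorm]
      ring
    refine step 2 _ q two_pos ?_ hq ?_ ?_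
    · compute_degree!
    · intro y _; rw [hev]; positivity
    · simp only [hev]
      exact .cos_sub_sq _ (sq_nonneg _)

/-! ### Sine polynomials and their coefficients -/

/-- The polynomial `∑_{k<N} c_{k+1} U_k`, which is `∑_{k=1}^N c_k sin (kt) / sin t` at `cos t`. -/
noncomputable def chebSum (N : ℕ) (c : ℕ → ℝ) : ℝ[X] :=
  ∑ k ∈ Finset.range N, c (k + 1) • Chebyshev.U ℝ (k : ℤ)

theorem natDegree_chebSum_le (N : ℕ) (c : ℕ → ℝ) : (chebSum N c).natDegree ≤ N - 1 := by
  refine natDegree_sum_le_of_forall_le _ _ fun k hk => (natDegree_smul_le _ _).trans ?_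
  rw [Chebyshev.natDegree_U_natCast]
  have := Finset.mem_range.mp hk
  omega

theorem chebSum_eval_cos_mul_sin (N : ℕ) (c : ℕ → ℝ) (t : ℝ) :
    (chebSum N c).eval (Real.cos t) * Real.sin t
      = ∑ k ∈ Finset.Icc 1 N, c k * Real.sin (k * t) := by
  rw [chebSum, eval_finsetSum, Finset.sum_mul]
  refine Finset.sum_bij' (fun j _ => j + 1) (fun l _ => l - 1) ?_ ?_ ?_ ?_ ?_
  any_goals intro a ha; simp only [Finset.mem_range, Finset.mem_Icc] at *; omega
  intro k _
  rw [eval_smul, smul_eq_mul, mul_assoc, Chebyshev.U_real_cos]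
  push_cast
  rfl

/-- The sum is `sin t` times a polynomial in `cos t`, which vanishes on `(-1, 1)` and so
identically; the `U_k` are independent because their degrees differ. -/
theorem sine_coeff_unique (N : ℕ) (c : ℕ → ℝ)
    (h : ∀ t : ℝ, ∑ k ∈ Finset.Icc 1 N, c k * Real.sin (k * t) = 0) :
    ∀ k ∈ Finset.Icc 1 N, c k = 0 := by
  have hzero : chebSum N c = 0 := by
    refine eq_zero_of_infinite_isRoot _ ((Set.Ioo_infinite (a := (-1 : ℝ)) (b := 1)
      (by norm_num)).mono fun x hx => ?_)
    have h1 := chebSum_eval_cos_mul_sin N c (Real.arccos x)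
    rw [h, Real.cos_arccos hx.1.le hx.2.le] at h1
    have hs : Real.sin (Real.arccos x) ≠ 0 := by
      rw [Real.sin_arccos]
      exact (Real.sqrt_pos.mpr (by nlinarith [hx.1, hx.2])).ne'
    exact (mul_eq_zero.mp h1).resolve_right hs
  let S : Polynomial.Sequence ℝ :=
    ⟨fun k => Chebyshev.U ℝ (k : ℤ), fun k => Chebyshev.degree_U_natCast ℝ k⟩
  have hli := linearIndependent_iff'.mp S.linearIndependent (Finset.range N) (fun k => c (k + 1))
    hzero
  intro k hk
  obtain ⟨h1, h2⟩ := Finset.mem_Icc.mp hk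
  have := hli (k - 1) (Finset.mem_range.mpr (by omega))
  simpa [Nat.sub_add_cancel h1] using this

/-- The `k`-th sine coefficient of `sin t · |∑ v_j e^{ijt}|²`. -/
noncomputable def sineCoeff {N : ℕ} (v : Fin N → ℝ) (k : ℕ) : ℝ :=
  ∑ i : Fin N, ∑ j : Fin N, v i * v j *
    ((if (i : ℕ) + 1 = j + k then 1 else 0) - (if (i : ℕ) + 1 + k = j then 1 else 0))

theorem sum_sum_swap_mul {N : ℕ} (v : Fin N → ℝ) (f : Fin N → Fin N → ℝ) :
    ∑ i, ∑ j, v i * v j * f i j = ∑ i, ∑ j, v i * v j * f j i := by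
  rw [Finset.sum_comm]
  exact Finset.sum_congr rfl fun i _ => Finset.sum_congr rfl fun j _ => by ring

theorem sum_indicator_mul (N : ℕ) (i j : Fin N) (g : ℕ → ℝ) :
    ∑ k ∈ Finset.Icc 1 N, ((if (i : ℕ) + 1 = j + k then (1 : ℝ) else 0)
      - (if (i : ℕ) + 1 + k = j then 1 else 0)) * g k
      = (if (j : ℕ) ≤ i then g (i + 1 - j) else 0) - if (i : ℕ) + 2 ≤ j then g (j - i - 1) else 0 := by
  have hi := i.isLt
  have hj := j.isLt
  simp only [sub_mul, Finset.sum_sub_distrib, ite_mul, one_mul, zero_mul]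
  congr 1
  · split_ifs with h
    · rw [Finset.sum_eq_single ((i : ℕ) + 1 - j)]
      · rw [if_pos (by omega)]
      · intro b _ hb; rw [if_neg (by omega)]
      · intro hb; exact absurd (Finset.mem_Icc.mpr (by omega)) hb
    · exact Finset.sum_eq_zero fun k hk => by
        have := Finset.mem_Icc.mp hk
        rw [if_neg (by omega)]
  · split_ifs with h
    · rw [Finset.sum_eq_single ((j : ℕ) - i - 1)]
      · rw [if_pos (by omega)]
      · intro b _ hb; rw [if_neg (by omega)]
      · intro hb; exact absurd (Finset.mem_Icc.mpr (by omega)) hb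
    · exact Finset.sum_eq_zero fun k hk => by
        have := Finset.mem_Icc.mp hk
        rw [if_neg (by omega)]

theorem sum_sineCoeff_mul {N : ℕ} (v : Fin N → ℝ) (g : ℕ → ℝ) :
    ∑ k ∈ Finset.Icc 1 N, sineCoeff v k * g k = ∑ i : Fin N, ∑ j : Fin N, v i * v j *
      ((if (j : ℕ) ≤ i then g (i + 1 - j) else 0) - if (i : ℕ) + 2 ≤ j then g (j - i - 1) else 0) := by
  simp only [← sum_indicator_mul, sineCoeff, Finset.sum_mul, Finset.mul_sum]
  rw [Finset.sum_comm]
  refine Finset.sum_congr rfl fun i _ => ?_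
  rw [Finset.sum_comm]
  exact Finset.sum_congr rfl fun j _ => Finset.sum_congr rfl fun k _ => by ring

/-- Both sides equal `∑ v_i v_j sin((i - j + 1)t)`. By the addition theorem its part with `sin((i -
j)t) cos t` is antisymmetric in `i, j` and cancels; the rest is `|P|² sin t`. -/
theorem normSq_mul_sin_eq_sum_sineCoeff {N : ℕ} (P : ℝ[X]) (hP : P.natDegree < N) (t : ℝ) :
    Complex.normSq (aeval (Complex.exp (t * Complex.I)) P) * Real.sin t
      = ∑ k ∈ Finset.Icc 1 N, sineCoeff (fun i : Fin N => P.coeff i) k * Real.sin (k * t) := by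
  rw [sum_sineCoeff_mul]
  set v : Fin N → ℝ := fun i => P.coeff i with hv
  have hre : (aeval (Complex.exp (t * Complex.I)) P).re = ∑ i, v i * Real.cos (i * t) ∧
      (aeval (Complex.exp (t * Complex.I)) P).im = ∑ i, v i * Real.sin (i * t) := by
    have h1 : aeval (Complex.exp (t * Complex.I)) P
        = ∑ i : Fin N, (v i : ℂ) * Complex.exp (((i * t : ℝ) : ℂ) * Complex.I) := by
      rw [aeval_eq_sum_range' hP, ← Fin.sum_univ_eq_sum_range
        (fun i => P.coeff i • Complex.exp (t * Complex.I) ^ i)]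
      refine Finset.sum_congr rfl fun i _ => ?_
      rw [← Complex.exp_nat_mul, Complex.real_smul]
      congr 2
      push_cast; ring
    rw [h1, Complex.re_sum, Complex.im_sum]
    simp only [Complex.re_ofReal_mul, Complex.im_ofReal_mul, Complex.exp_ofReal_mul_I_re,
      Complex.exp_ofReal_mul_I_im, and_self]
  have hpt : ∀ i j : Fin N, ((if (j : ℕ) ≤ i then Real.sin (((i + 1 - j : ℕ) : ℝ) * t) else 0)
      - if (i : ℕ) + 2 ≤ j then Real.sin (((j - i - 1 : ℕ) : ℝ) * t) else 0)
      = Real.sin (((i : ℝ) - j) * t) * Real.cos t + Real.cos (((i : ℝ) - j) * t) * Real.sin t := by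
    intro i j
    rw [← Real.sin_add]
    split_ifs with h1 h2 h2
    · omega
    · rw [Nat.cast_sub (by omega)]; push_cast; rw [sub_zero]; congr 1; ring
    · rw [Nat.cast_sub (by omega), Nat.cast_sub (by omega), zero_sub, ← Real.sin_neg]
      congr 1; push_cast; ring
    -- For `j = i + 1` no index `k` contributes, in accordance with `sin 0 = 0`.
    · have : (j : ℕ) = i + 1 := by omega
      rw [this]; push_cast; ring_nf; simp
  have hanti : ∑ i : Fin N, ∑ j : Fin N, v i * v j * (Real.sin (((i : ℝ) - j) * t) * Real.cos t) = 0 := by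
    have h := sum_sum_swap_mul v fun i j => Real.sin (((i : ℝ) - j) * t) * Real.cos t
    have h2 : ∑ i : Fin N, ∑ j : Fin N, v i * v j * (Real.sin (((j : ℝ) - i) * t) * Real.cos t)
        = - ∑ i : Fin N, ∑ j : Fin N, v i * v j * (Real.sin (((i : ℝ) - j) * t) * Real.cos t) := by
      simp only [← Finset.sum_neg_distrib]
      refine Finset.sum_congr rfl fun i _ => Finset.sum_congr rfl fun j _ => ?_
      rw [show ((j : ℝ) - i) * t = -(((i : ℝ) - j) * t) by ring, Real.sin_neg]; ring
    linarith
  simp only [hpt]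
  simp only [mul_add, Finset.sum_add_distrib]
  rw [hanti, zero_add, Complex.normSq_apply, hre.1, hre.2, Finset.sum_mul_sum, Finset.sum_mul_sum,
    ← Finset.sum_add_distrib, Finset.sum_mul]
  refine Finset.sum_congr rfl fun i _ => ?_
  rw [← Finset.sum_add_distrib, Finset.sum_mul]
  refine Finset.sum_congr rfl fun j _ => ?_
  rw [sub_mul, Real.cos_sub]; ring

theorem sum_shift_indicator (N m : ℕ) (z : ℕ → ℝ) :
    ∑ i : Fin N, ∑ j : Fin N, z (i + 1) * z (j + 1) * (if (i : ℕ) = j + m then 1 else 0)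
      = ∑ l ∈ Finset.Icc 1 (N - m), z l * z (l + m) := by
  rw [Finset.sum_comm]
  have h1 : ∀ j : Fin N, ∑ i : Fin N, z (i + 1) * z (j + 1) * (if (i : ℕ) = j + m then 1 else 0)
      = if (j : ℕ) < N - m then z (j + 1) * z (j + 1 + m) else 0 := by
    intro j
    split_ifs with h
    · rw [Finset.sum_eq_single ⟨j + m, by omega⟩]
      · simp only [if_true]; rw [add_right_comm]; ring
      · intro b _ hb
        rw [if_neg (fun hh => hb (Fin.ext hh)), mul_zero]
      · simp
    · refine Finset.sum_eq_zero fun i _ => ?_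
      have := i.isLt
      rw [if_neg (by omega), mul_zero]
  simp only [h1]
  rw [Fin.sum_univ_eq_sum_range (fun j => if j < N - m then z (j + 1) * z (j + 1 + m) else 0) N,
    ← Finset.sum_filter]
  refine Finset.sum_bij' (fun j _ => j + 1) (fun l _ => l - 1) ?_ ?_ ?_ ?_ ?_
  all_goals intro a ha; simp only [Finset.mem_filter, Finset.mem_range, Finset.mem_Icc] at *
  all_goals omega

/-- This is `r_{k-1} - r_{k+1}` for the autocorrelations `r_m`; the truncated `N - (k + 1)` gives an
empty second sum once `k + 1 ≥ N`. -/
theorem sineCoeff_eq_sum (N : ℕ) (z : ℕ → ℝ) {k : ℕ} (hk : 1 ≤ k) :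
    sineCoeff (fun i : Fin N => z (i + 1)) k
      = ∑ l ∈ Finset.Icc 1 (N - (k - 1)), z l * z (l + (k - 1))
        - ∑ l ∈ Finset.Icc 1 (N - (k + 1)), z l * z (l + (k + 1)) := by
  simp only [sineCoeff, mul_sub, Finset.sum_sub_distrib]
  congr 1
  · rw [← sum_shift_indicator]
    refine Finset.sum_congr rfl fun i _ => Finset.sum_congr rfl fun j _ => ?_
    congr 2
    simp only [eq_iff_iff]; omega
  · rw [← sum_shift_indicator, Finset.sum_comm]
    refine Finset.sum_congr rfl fun i _ => Finset.sum_congr rfl fun j _ => ?_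
    rw [mul_comm (z _)]
    congr 2
    simp only [eq_iff_iff]; omega

theorem sineCoeff_one_eq_denom (N : ℕ) (z : ℕ → ℝ) :
    sineCoeff (fun i : Fin N => z (i + 1)) 1 = denom N z := by
  rw [sineCoeff_eq_sum N z le_rfl]; rfl

/-! ### The quadratic form of the pencil and its ground state -/

/-- The matrix `c (I - B) - (I + A)`. -/
noncomputable def pencil (N : ℕ) (c : ℝ) : Matrix (Fin N) (Fin N) ℝ :=
  c • (1 - matB N) - (1 + matA N)

theorem pencil_apply (N : ℕ) (c : ℝ) (i j : Fin N) :
    pencil N c i j = c * ((if i = j then 1 else 0)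
      - (if (i : ℕ) + 2 = j ∨ (j : ℕ) + 2 = i then 1 / 2 else 0))
      - ((if i = j then 1 else 0) + (if (i : ℕ) + 1 = j ∨ (j : ℕ) + 1 = i then 1 / 2 else 0)) := by
  simp [pencil, matA, matB, Matrix.one_apply]

theorem pencil_symm (N : ℕ) (c : ℝ) (i j : Fin N) : pencil N c i j = pencil N c j i := by
  simp only [pencil_apply, eq_comm (a := i) (b := j), or_comm]

theorem pencil_quadratic_form {N : ℕ} (c : ℝ) (v : Fin N → ℝ) :
    c * sineCoeff v 1 - ∑ k ∈ Finset.Icc 1 N, sineCoeff v k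
      = ∑ i, ∑ j, v i * v j * pencil N c i j := by
  have h1 := sum_sineCoeff_mul v fun _ => 1
  simp only [mul_one] at h1
  rw [h1, sineCoeff, Finset.mul_sum, ← Finset.sum_sub_distrib]
  simp only [Finset.mul_sum, ← Finset.sum_sub_distrib]
  set f : Fin N → Fin N → ℝ := fun i j =>
    c * ((if (i : ℕ) + 1 = j + 1 then 1 else 0) - (if (i : ℕ) + 1 + 1 = j then 1 else 0)) -
    ((if (j : ℕ) ≤ i then 1 else 0) - if (i : ℕ) + 2 ≤ j then 1 else 0) with hf
  have h2 := sum_sum_swap_mul v f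
  -- The kernel `f` read off from the coefficients is not symmetric; its symmetrization is the
  -- pencil.
  have h3 : ∑ i, ∑ j, v i * v j * f i j + ∑ i, ∑ j, v i * v j * f j i
      = 2 * ∑ i, ∑ j, v i * v j * pencil N c i j := by
    simp only [Finset.mul_sum, ← Finset.sum_add_distrib]
    refine Finset.sum_congr rfl fun i _ => Finset.sum_congr rfl fun j _ => ?_
    have h4 : f i j + f j i = 2 * pencil N c i j := by
      simp only [hf, pencil_apply, Fin.ext_iff]
      generalize (i : ℕ) = a
      generalize (j : ℕ) = b
      rcases (by omega : a = b ∨ a + 1 = b ∨ a + 2 = b ∨ a + 3 ≤ b ∨ b + 1 = a ∨ b + 2 = a ∨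
        b + 3 ≤ a) with h | h | h | h | h | h | h <;>
      simp (disch := omega) only [if_pos, if_neg] <;> ring
    linear_combination v i * v j * h4
  have h5 : ∑ i, ∑ j, v i * v j * f i j = ∑ i, ∑ j, v i * v j * pencil N c i j := by linarith
  rw [← h5]
  refine Finset.sum_congr rfl fun i _ => Finset.sum_congr rfl fun j _ => ?_
  simp only [hf]; ring

/-- Ground state representation of the quadratic form of a symmetric matrix with a null vector. -/
theorem ground_state_representation {ι : Type*} [Fintype ι] (M : ι → ι → ℝ)
    (hM : ∀ i j, M i j = M j i) (z : ι → ℝ) (hz : ∀ i, z i ≠ 0) (h0 : ∀ i, ∑ j, M i j * z j = 0)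
    (v : ι → ℝ) :
    ∑ i, ∑ j, v i * v j * M i j
      = ∑ i, ∑ j, -(1 / 2) * (M i j * (z i * z j)) * (v i / z i - v j / z j) ^ 2 := by
  have h1 : ∑ i, ∑ j, (v i / z i) ^ 2 * z i * (M i j * z j) = 0 := by
    simp only [← Finset.mul_sum, h0, mul_zero, Finset.sum_const_zero]
  have h2 : ∑ i, ∑ j, (v j / z j) ^ 2 * z j * (M i j * z i) = 0 := by
    rw [Finset.sum_comm, ← h1]
    exact Finset.sum_congr rfl fun i _ => Finset.sum_congr rfl fun j _ => by rw [hM]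
  have h3 : ∑ i, ∑ j, -(1 / 2) * (M i j * (z i * z j)) * (v i / z i - v j / z j) ^ 2
      = ∑ i, ∑ j, v i * v j * M i j
        - (1 / 2) * ∑ i, ∑ j, (v i / z i) ^ 2 * z i * (M i j * z j)
        - (1 / 2) * ∑ i, ∑ j, (v j / z j) ^ 2 * z j * (M i j * z i) := by
    simp only [Finset.mul_sum, ← Finset.sum_sub_distrib]
    refine Finset.sum_congr rfl fun i _ => Finset.sum_congr rfl fun j _ => ?_
    have := hz i
    have := hz j
    field_simp
    ring
  rw [h3, h1, h2]; ring

theorem pencil_mul_nonpos {N : ℕ} {c : ℝ} (hc : 0 < c) {i j : Fin N} (hij : i ≠ j) :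
    pencil N c i j ≤ 0 := by
  rw [pencil_apply, if_neg hij]
  split_ifs <;> linarith

section GroundState

variable {N : ℕ} {c : ℝ} {z : Fin N → ℝ}

theorem pencil_form_term_nonneg (hc : 0 < c) (hz : ∀ i j, 0 < z i * z j) (v : Fin N → ℝ)
    (i j : Fin N) :
    0 ≤ -(1 / 2) * (pencil N c i j * (z i * z j)) * (v i / z i - v j / z j) ^ 2 := by
  rcases eq_or_ne i j with rfl | hij
  · simp
  · have := mul_nonneg (neg_nonneg.mpr (pencil_mul_nonpos hc hij)) (hz i j).le
    exact mul_nonneg (by linarith) (sq_nonneg _)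

theorem pencil_form_nonneg (hc : 0 < c) (hz : ∀ i j, 0 < z i * z j)
    (h0 : ∀ i, ∑ j, pencil N c i j * z j = 0) (v : Fin N → ℝ) :
    0 ≤ ∑ i, ∑ j, v i * v j * pencil N c i j := by
  rw [ground_state_representation _ (pencil_symm N c) z
    (fun i hi => by simpa [hi] using hz i i) h0]
  exact Finset.sum_nonneg fun i _ => Finset.sum_nonneg fun j _ => pencil_form_term_nonneg hc hz v i j

/-- Every term of the ground state representation must vanish. The entries next to the diagonal are
`-1/2`, so the ratios `v_i / z_i` agree at neighbouring indices and hence everywhere. -/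
theorem eq_smul_of_pencil_form_eq_zero (hc : 0 < c) (hz : ∀ i j, 0 < z i * z j)
    (h0 : ∀ i, ∑ j, pencil N c i j * z j = 0) (v : Fin N → ℝ)
    (hv : ∑ i, ∑ j, v i * v j * pencil N c i j = 0) : ∃ s : ℝ, ∀ i, v i = s * z i := by
  have hne : ∀ i, z i ≠ 0 := fun i hi => by simpa [hi] using hz i i
  rw [ground_state_representation _ (pencil_symm N c) z hne h0] at hv
  have hterm : ∀ i j, -(1 / 2) * (pencil N c i j * (z i * z j)) * (v i / z i - v j / z j) ^ 2 = 0 := by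
    intro i j
    have h1 := (Finset.sum_eq_zero_iff_of_nonneg fun i _ =>
      Finset.sum_nonneg fun j _ => pencil_form_term_nonneg hc hz v i j).mp hv i (Finset.mem_univ i)
    exact (Finset.sum_eq_zero_iff_of_nonneg fun j _ =>
      pencil_form_term_nonneg hc hz v i j).mp h1 j (Finset.mem_univ j)
  have hstep : ∀ i j : Fin N, (i : ℕ) + 1 = j → v i / z i = v j / z j := by
    intro i j hij
    have hp : pencil N c i j = -(1 / 2) := by
      rw [pencil_apply, if_neg (fun h => by rw [h] at hij; omega), if_neg (by omega),
        if_pos (Or.inl hij)]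
      ring
    have h1 := hterm i j
    rw [hp] at h1
    have h2 : (v i / z i - v j / z j) ^ 2 = 0 := by
      refine (mul_eq_zero.mp h1).resolve_left ?_
      have := hz i j
      intro h; linarith
    exact sub_eq_zero.mp (pow_eq_zero_iff two_ne_zero |>.mp h2)
  rcases Nat.eq_zero_or_pos N with rfl | hN
  · exact ⟨0, fun i => i.elim0⟩
  refine ⟨v ⟨0, hN⟩ / z ⟨0, hN⟩, fun i => ?_⟩
  have hall : ∀ (m : ℕ) (hm : m < N), v ⟨m, hm⟩ / z ⟨m, hm⟩ = v ⟨0, hN⟩ / z ⟨0, hN⟩ := by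
    intro m
    induction m with
    | zero => intro _; rfl
    | succ m ih => intro hm; rw [← ih (by omega)]; exact (hstep _ _ rfl).symm
  rw [← hall i i.isLt, div_mul_cancel₀ _ (hne i)]

end GroundState

/-! ### From a principal vector of one sign to the extremal polynomial -/

theorem sineCoeff_smul {N : ℕ} {z v : Fin N → ℝ} {s : ℝ} (h : ∀ i, v i = s * z i) (k : ℕ) :
    sineCoeff v k = s ^ 2 * sineCoeff z k := by
  simp only [sineCoeff, h, Finset.mul_sum]
  exact Finset.sum_congr rfl fun i _ => Finset.sum_congr rfl fun j _ => by ring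

theorem IsAdmissible.exists_sineCoeff {N : ℕ} (hN : 1 ≤ N) {G : ℝ[X]} (hG : IsAdmissible N G) :
    ∃ (ι : Type) (_ : Fintype ι) (v : ι → Fin N → ℝ),
      ∀ k ∈ Finset.Icc 1 N, G.coeff k = ∑ m, sineCoeff (v m) k := by
  obtain ⟨-, -, -, hpos⟩ := hG
  set p := chebSum N G.coeff with hp
  have hnn : ∀ x ∈ Set.Icc (-1 : ℝ) 1, 0 ≤ p.eval x := by
    -- The factor `sin t` vanishes at the endpoints, so positivity is obtained on the open interval
    -- and extended by continuity.
    have hsub : closure (Set.Ioo (-1 : ℝ) 1) ⊆ {x | 0 ≤ p.eval x} := by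
      refine closure_minimal (fun x hx => ?_) (isClosed_le continuous_const p.continuous)
      have h1 := chebSum_eval_cos_mul_sin N G.coeff (Real.arccos x)
      rw [Real.cos_arccos hx.1.le hx.2.le] at h1
      have h2 := hpos _ ⟨Real.arccos_nonneg x, Real.arccos_le_pi x⟩
      rw [← h1] at h2
      refine nonneg_of_mul_nonneg_left h2 ?_
      rw [Real.sin_arccos]
      exact Real.sqrt_pos.mpr (by nlinarith [hx.1, hx.2])
    rwa [closure_Ioo (by norm_num)] at hsub
  obtain ⟨ι, hι, P, hdeg, hP⟩ := isTrigSOS_eval_cos (N - 1) p (natDegree_chebSum_le N _) hnn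
  refine ⟨ι, hι, fun m i => (P m).coeff i, fun k hk => sub_eq_zero.mp ?_⟩
  refine sine_coeff_unique N (fun k => G.coeff k - ∑ m, sineCoeff (fun i : Fin N => (P m).coeff i) k)
    (fun t => ?_) k hk
  simp only [sub_mul, Finset.sum_sub_distrib, Finset.sum_mul]
  rw [Finset.sum_comm, ← chebSum_eval_cos_mul_sin, ← hp,
    show p.eval (Real.cos t) = _ from hP t, Finset.sum_mul, sub_eq_zero]
  exact Finset.sum_congr rfl fun m _ =>
    normSq_mul_sin_eq_sum_sineCoeff (P m) (by have := hdeg m; omega) t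

theorem IsPrincipalVector.pencil_eq_zero {N : ℕ} {c : ℝ} {z : ℕ → ℝ} (h : IsPrincipalVector N c z)
    (i : Fin N) : ∑ j : Fin N, pencil N c i j * z (j + 1) = 0 := by
  have h1 := h.2
  have h2 : (pencil N c).mulVec (fun i : Fin N => z (i + 1)) = 0 := by
    rw [pencil, Matrix.sub_mulVec, Matrix.smul_mulVec, h1, sub_self]
  exact congrFun h2 i

/-- A principal vector with coordinates of one sign solves the extremal problem. -/
theorem extremal_of_principal_vector {N : ℕ} (hN : 1 ≤ N) {c : ℝ} (hc : 0 < c) {z : ℕ → ℝ}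
    (hz : IsPrincipalVector N c z)
    (hpos : ∀ i ∈ Finset.Icc 1 N, ∀ j ∈ Finset.Icc 1 N, 0 < z i * z j) :
    0 < denom N z ∧ (∃! F : ℝ[X], IsExtremal N F) ∧
      ∀ F : ℝ[X], IsExtremal N F → CoeffsGivenBy N z F := by
  set w : Fin N → ℝ := fun i => z (i + 1) with hw
  have hwpos : ∀ i j, 0 < w i * w j := fun i j =>
    hpos _ (Finset.mem_Icc.mpr (by omega)) _ (Finset.mem_Icc.mpr (by omega))
  have h0 : ∀ i, ∑ j, pencil N c i j * w j = 0 := hz.pencil_eq_zero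
  have hden : sineCoeff w 1 = denom N z := sineCoeff_one_eq_denom N z
  have hq : c * sineCoeff w 1 = ∑ k ∈ Finset.Icc 1 N, sineCoeff w k := by
    have h1 := pencil_quadratic_form c w
    have h2 : ∑ i, ∑ j, w i * w j * pencil N c i j = 0 := by
      have : ∀ i, ∑ j, w i * w j * pencil N c i j = w i * ∑ j, pencil N c i j * w j := fun i => by
        rw [Finset.mul_sum]; exact Finset.sum_congr rfl fun j _ => by ring
      simp [this, h0]
    linarith
  have hsum : 0 < ∑ k ∈ Finset.Icc 1 N, sineCoeff w k := by
    -- At `c = 0` the pencil is `-(I + A)`, whose entries are nonpositive; so the coefficient sum is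
    -- positive, and `c · D` equals it.
    have h1 := pencil_quadratic_form 0 w
    have h2 : 0 < ∑ i, ∑ j, w i * w j * -pencil N 0 i j := by
      have hnn : ∀ i j, 0 ≤ w i * w j * -pencil N 0 i j := fun i j => by
        refine mul_nonneg (hwpos i j).le ?_
        rw [pencil_apply]; split_ifs <;> norm_num
      refine Finset.sum_pos' (fun i _ => Finset.sum_nonneg fun j _ => hnn i j)
        ⟨⟨0, hN⟩, Finset.mem_univ _, Finset.sum_pos' (fun j _ => hnn _ j)
          ⟨⟨0, hN⟩, Finset.mem_univ _, mul_pos (hwpos _ _) ?_⟩⟩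
      rw [pencil_apply]; norm_num
    simp only [mul_neg, Finset.sum_neg_distrib] at h2
    linarith
  have hD : 0 < denom N z := by
    rw [← hden]
    rw [← hq] at hsum
    exact (mul_pos_iff_of_pos_left hc).mp hsum
  have hbound : ∀ G, IsAdmissible N G → ∑ j ∈ Finset.Icc 1 N, G.coeff j ≤ c ∧
      (∑ j ∈ Finset.Icc 1 N, G.coeff j = c →
        ∀ k ∈ Finset.Icc 1 N, G.coeff k = sineCoeff w k / denom N z) := by
    intro G hG
    obtain ⟨ι, _, v, hv⟩ := hG.exists_sineCoeff hN
    have hone := hv 1 (Finset.mem_Icc.mpr ⟨le_rfl, hN⟩)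
    rw [hG.2.2.1] at hone
    -- The normalization `α_1 = 1` turns `c` into `c · α_1`.
    have hgap : c - ∑ j ∈ Finset.Icc 1 N, G.coeff j
        = ∑ m, ∑ i, ∑ j, v m i * v m j * pencil N c i j := by
      simp only [← pencil_quadratic_form, Finset.sum_sub_distrib, ← Finset.mul_sum]
      rw [← hone, mul_one, Finset.sum_comm, Finset.sum_congr rfl hv]
    have hnn : ∀ m, 0 ≤ ∑ i, ∑ j, v m i * v m j * pencil N c i j := fun m =>
      pencil_form_nonneg hc hwpos h0 (v m)
    refine ⟨by linarith [Finset.sum_nonneg fun m (_ : m ∈ Finset.univ) => hnn m], fun heq => ?_⟩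
    rw [heq, sub_self] at hgap
    have hzero := fun m => (Finset.sum_eq_zero_iff_of_nonneg fun m _ => hnn m).mp hgap.symm m
      (Finset.mem_univ m)
    choose s hs using fun m => eq_smul_of_pencil_form_eq_zero hc hwpos h0 (v m) (hzero m)
    have hk : ∀ k ∈ Finset.Icc 1 N, G.coeff k = (∑ m, s m ^ 2) * sineCoeff w k := by
      intro k hk
      rw [hv k hk, Finset.sum_mul]
      exact Finset.sum_congr rfl fun m _ => sineCoeff_smul (hs m) k
    have hS := hk 1 (Finset.mem_Icc.mpr ⟨le_rfl, hN⟩)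
    rw [hG.2.2.1, hden] at hS
    intro k hk'
    rw [hk k hk', eq_div_iff hD.ne']
    linear_combination -sineCoeff w k * hS
  set F : ℝ[X] := ∑ k ∈ Finset.Icc 1 N, monomial k (sineCoeff w k / denom N z) with hF
  have hFc : ∀ k, F.coeff k = if k ∈ Finset.Icc 1 N then sineCoeff w k / denom N z else 0 := by
    intro k
    simp [hF, coeff_monomial]
  have hFk : ∀ k ∈ Finset.Icc 1 N, F.coeff k = sineCoeff w k / denom N z := fun k hk => by
    rw [hFc, if_pos hk]
  have hFadm : IsAdmissible N F := by
    refine ⟨?_, ?_, ?_, ?_⟩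
    · refine natDegree_le_iff_coeff_eq_zero.mpr fun k hk => ?_
      rw [hFc, if_neg (by simp; omega)]
    · rw [hFc, if_neg (by simp)]
    · rw [hFk 1 (by simpa using hN), hden, div_self hD.ne']
    -- Up to the factor `1 / D`, the sine sum of `F` is `sin t` times the squared modulus of the
    -- polynomial with coefficients `z`.
    · intro t ht
      have hvec : w = fun i : Fin N =>
          (∑ k ∈ Finset.range N, monomial k (z (k + 1)) : ℝ[X]).coeff i := by
        funext i
        simp [coeff_monomial, hw]
      have h1 := normSq_mul_sin_eq_sum_sineCoeff (N := N)
        (∑ k ∈ Finset.range N, monomial k (z (k + 1)))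
        (lt_of_le_of_lt (natDegree_sum_le_of_forall_le _ _ (n := N - 1) fun k hk =>
          (natDegree_monomial_le _).trans (by have := Finset.mem_range.mp hk; omega))
          (by omega)) t
      rw [← hvec] at h1
      have h2 : ∑ j ∈ Finset.Icc 1 N, F.coeff j * Real.sin (j * t)
          = (∑ j ∈ Finset.Icc 1 N, sineCoeff w j * Real.sin (j * t)) / denom N z := by
        rw [Finset.sum_div]
        exact Finset.sum_congr rfl fun k hk => by rw [hFk k hk]; ring
      rw [h2, ← h1]
      exact div_nonneg (mul_nonneg (Complex.normSq_nonneg _)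
        (Real.sin_nonneg_of_nonneg_of_le_pi ht.1 ht.2)) hD.le
  have hFsum : ∑ k ∈ Finset.Icc 1 N, F.coeff k = c := by
    rw [Finset.sum_congr rfl hFk, ← Finset.sum_div, ← hq, hden, mul_div_cancel_right₀ _ hD.ne']
  have hFext : IsExtremal N F := ⟨hFadm, fun G hG => by rw [hFsum]; exact (hbound G hG).1⟩
  have huniq : ∀ G, IsExtremal N G → G = F := by
    intro G hG
    have hsum : ∑ k ∈ Finset.Icc 1 N, G.coeff k = c :=
      le_antisymm (hbound G hG.1).1 (hFsum ▸ hG.2 F hFadm)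
    ext k
    by_cases hk : k ∈ Finset.Icc 1 N
    · rw [(hbound G hG.1).2 hsum k hk, hFk k hk]
    · rw [hFc, if_neg hk]
      rcases Nat.eq_zero_or_pos k with rfl | h
      · exact hG.1.2.1
      · exact coeff_eq_zero_of_natDegree_lt (lt_of_le_of_lt hG.1.1
          (by simp only [Finset.mem_Icc] at hk; omega))
  refine ⟨hD, ⟨F, hFext, huniq⟩, fun G hG => ?_⟩
  rw [huniq G hG]
  refine ⟨fun k h1 h2 => ?_, fun h2 => ?_, ?_⟩
  · rw [hFk k (Finset.mem_Icc.mpr (by omega)), sineCoeff_eq_sum N z h1]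
    congr 2
    · rw [show N - (k - 1) = N - k + 1 by omega]
      exact Finset.sum_congr rfl fun j _ => by rw [Nat.add_sub_assoc h1]
  · rw [hFk (N - 1) (Finset.mem_Icc.mpr (by omega)), sineCoeff_eq_sum N z (by omega),
      show N - (N - 1 - 1) = 2 by omega, show N - (N - 1 + 1) = 0 by omega]
    simp only [Finset.sum_Icc_succ_top (show 1 ≤ 1 + 1 by norm_num), Finset.Icc_self,
      Finset.sum_singleton, Finset.Icc_eq_empty (show ¬ (1 ≤ 0) by norm_num), Finset.sum_empty]
    rw [show 1 + (N - 1 - 1) = N - 1 by omega, show 1 + 1 + (N - 1 - 1) = N by omega, sub_zero]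
  · rw [hFk N (Finset.mem_Icc.mpr (by omega)), sineCoeff_eq_sum N z hN,
      show N - (N - 1) = 1 by omega, show N - (N + 1) = 0 by omega]
    simp only [Finset.Icc_self, Finset.sum_singleton,
      Finset.Icc_eq_empty (show ¬ (1 ≤ 0) by norm_num), Finset.sum_empty]
    rw [show 1 + (N - 1) = N by omega, sub_zero]

/-! ### Principal vectors from a five-term recurrence -/

/-- Since `f` vanishes at the `d` places beyond either end, the truncated rows of the band matrix
act like the full shift operator. -/
theorem sum_band_mul {N d : ℕ} (hd : 0 < d) (f : ℤ → ℝ)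
    (hlo : ∀ k : ℤ, -d < k → k ≤ 0 → f k = 0) (hhi : ∀ k : ℤ, N < k → k ≤ N + d → f k = 0)
    (i : Fin N) :
    ∑ j : Fin N, (if (i : ℕ) + d = j ∨ (j : ℕ) + d = i then (1 / 2 : ℝ) else 0) * f ((j : ℕ) + 1)
      = (f ((i : ℕ) + 1 + d) + f ((i : ℕ) + 1 - d)) / 2 := by
  have hi := i.isLt
  have hsplit : ∀ j : Fin N,
      (if (i : ℕ) + d = j ∨ (j : ℕ) + d = i then (1 / 2 : ℝ) else 0) * f ((j : ℕ) + 1)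
      = (if (i : ℕ) + d = j then f ((j : ℕ) + 1) / 2 else 0)
        + (if (j : ℕ) + d = i then f ((j : ℕ) + 1) / 2 else 0) := by
    intro j
    split_ifs <;> first | omega | ring
  simp only [hsplit, Finset.sum_add_distrib]
  have h1 : ∑ j : Fin N, (if (i : ℕ) + d = j then f ((j : ℕ) + 1) / 2 else 0)
      = f ((i : ℕ) + 1 + d) / 2 := by
    by_cases h : (i : ℕ) + d < N
    · rw [Finset.sum_eq_single ⟨i + d, h⟩]
      · simp only [if_true]; push_cast; congr 2; ring
      · intro b _ hb; rw [if_neg fun hh => hb (Fin.ext hh.symm)]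
      · simp
    · rw [hhi _ (by omega) (by omega), zero_div]
      refine Finset.sum_eq_zero fun j _ => ?_
      have := j.isLt
      rw [if_neg (by omega)]
  have h2 : ∑ j : Fin N, (if (j : ℕ) + d = i then f ((j : ℕ) + 1) / 2 else 0)
      = f ((i : ℕ) + 1 - d) / 2 := by
    by_cases h : d ≤ (i : ℕ)
    · rw [Finset.sum_eq_single ⟨i - d, by omega⟩]
      · rw [if_pos (Nat.sub_add_cancel h)]; push_cast [h]; congr 2; ring
      · intro b _ hb
        rw [if_neg fun hh => hb (Fin.ext (by simp only; omega))]
      · simp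
    · rw [hlo _ (by omega) (by omega), zero_div]
      exact Finset.sum_eq_zero fun j _ => by rw [if_neg (by omega)]
  rw [h1, h2]; ring

/-- A nonzero solution of the five-term recurrence that vanishes at `-1, 0, N + 1, N + 2` is a
principal vector. -/
theorem isPrincipalVector_of_recurrence {N : ℕ} {c : ℝ} {z : ℕ → ℝ} (f : ℤ → ℝ)
    (hz : ∀ k : ℕ, 1 ≤ k → z k = f k) (hm1 : f (-1) = 0) (h0 : f 0 = 0) (hN1 : f (N + 1) = 0)
    (hN2 : f (N + 2) = 0)
    (hrec : ∀ k : ℤ, f k + (f (k + 1) + f (k - 1)) / 2 = c * (f k - (f (k + 2) + f (k - 2)) / 2))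
    (hne : ∃ k, 1 ≤ k ∧ k ≤ N ∧ z k ≠ 0) : IsPrincipalVector N c z := by
  have hlo : ∀ k : ℤ, -2 < k → k ≤ 0 → f k = 0 := fun k h1 h2 => by
    obtain rfl | rfl : k = -1 ∨ k = 0 := by omega
    exacts [hm1, h0]
  have hhi : ∀ k : ℤ, N < k → k ≤ N + 2 → f k = 0 := fun k h1 h2 => by
    obtain rfl | rfl : k = N + 1 ∨ k = N + 2 := by omega
    exacts [hN1, hN2]
  have hzf : (fun i : Fin N => z ((i : ℕ) + 1)) = fun i : Fin N => f ((i : ℕ) + 1) := by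
    funext i; rw [hz _ (by omega)]; push_cast; rfl
  refine ⟨fun h => ?_, ?_⟩
  · obtain ⟨k, h1, h2, h3⟩ := hne
    have := congrFun h ⟨k - 1, by omega⟩
    simp only [Nat.sub_add_cancel h1] at this
    exact h3 this
  rw [hzf, Matrix.add_mulVec, Matrix.sub_mulVec, Matrix.one_mulVec]
  funext i
  have hA := sum_band_mul one_pos f (fun k h1 h2 => hlo k (by omega) h2)
    (fun k h1 h2 => hhi k h1 (by omega)) i
  have hB := sum_band_mul two_pos f (fun k h1 h2 => hlo k (by omega) h2)
    (fun k h1 h2 => hhi k h1 (by omega)) i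
  have := hrec ((i : ℕ) + 1)
  simp only [Pi.add_apply, Pi.smul_apply, Pi.sub_apply, Matrix.mulVec, dotProduct, matA, matB,
    Matrix.of_apply, smul_eq_mul]
  rw [hA, hB]
  push_cast
  exact this

theorem chebU_add_two (n : ℤ) (x : ℝ) : chebU (n + 2) x = 2 * x * chebU (n + 1) x - chebU n x := by
  simp [chebU, Chebyshev.U_add_two]

theorem chebU_neg_one (x : ℝ) : chebU (-1) x = 0 := by simp [chebU]

/-- With `x = cos θ`, the product is a constant plus a multiple of `cos((2k + 1)θ)`. The differences
with steps 1 and 2 annihilate the constant and multiply the cosine by `1 - cos 2θ` and `1 - cos 4θ`,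
whose ratio is `4x²`. -/
theorem chebU_mul_recurrence (x : ℝ) (k : ℤ) :
    4 * x ^ 2 * (chebU (k - 1) x * chebU k x
      - (chebU k x * chebU (k + 1) x + chebU (k - 2) x * chebU (k - 1) x) / 2)
      = chebU (k - 1) x * chebU k x
        - (chebU (k + 1) x * chebU (k + 2) x + chebU (k - 3) x * chebU (k - 2) x) / 2 := by
  have h1 := chebU_add_two k x
  have h2 := chebU_add_two (k - 1) x
  have h3 := chebU_add_two (k - 2) x
  have h4 := chebU_add_two (k - 3) x
  rw [show k - 1 + 2 = k + 1 by ring, show k - 1 + 1 = k by ring] at h2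
  rw [show k - 2 + 2 = k by ring, show k - 2 + 1 = k - 1 by ring] at h3
  rw [show k - 3 + 2 = k - 1 by ring, show k - 3 + 1 = k - 2 by ring] at h4
  replace h3 : chebU (k - 2) x = 2 * x * chebU (k - 1) x - chebU k x := by linarith
  replace h4 : chebU (k - 3) x = 2 * x * chebU (k - 2) x - chebU (k - 1) x := by linarith
  rw [h4, h1, h3, h2]
  ring

/-- The common form of `(-1)^(k-1) z_k^{(0)}` (`ε = 1`) and `(-1)^(k-1) z_k^{(1)}` (`ε = -1`). -/
noncomputable def chebWave (N : ℕ) (ε x : ℝ) (k : ℤ) : ℝ :=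
  chebU (k - 1) x * chebU k x + ε * (chebU (N - k) x * chebU (N - k + 1) x)
    + ((N : ℝ) + 1 - 2 * k) / ((N : ℝ) + 1) * (chebU N x * chebU (N + 1) x)

theorem zMu_eq_chebWave (N : ℕ) (x : ℝ) (k : ℕ) :
    zMu N x k = (-1) ^ (k - 1) * chebWave N 1 x k := by
  simp [zMu, chebWave]

theorem zNu_eq_chebWave (N : ℕ) (x : ℝ) (k : ℕ) :
    zNu N x k = (-1) ^ (k - 1) * chebWave N (-1) x k := by
  simp [zNu, chebWave, sub_eq_add_neg]

/-- The second product is the first one reflected by `k ↦ N + 1 - k`, and both differences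
annihilate the term affine in `k`. -/
theorem chebWave_recurrence (N : ℕ) (ε x : ℝ) (k : ℤ) :
    4 * x ^ 2 * (chebWave N ε x k - (chebWave N ε x (k + 1) + chebWave N ε x (k - 1)) / 2)
      = chebWave N ε x k - (chebWave N ε x (k + 2) + chebWave N ε x (k - 2)) / 2 := by
  have h1 := chebU_mul_recurrence x k
  have h2 := chebU_mul_recurrence x (N - k + 1)
  simp only [chebWave]
  rw [show k + 1 - 1 = k by ring, show k - 1 - 1 = k - 2 by ring, show k + 2 - 1 = k + 1 by ring,
    show k - 2 - 1 = k - 3 by ring, show (N : ℤ) - (k + 1) = N - k - 1 by ring,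
    show (N : ℤ) - (k - 1) = N - k + 1 by ring, show (N : ℤ) - (k + 2) = N - k - 2 by ring,
    show (N : ℤ) - (k - 2) = N - k + 2 by ring, show (N : ℤ) - k - 1 + 1 = N - k by ring,
    show (N : ℤ) - k + 1 + 1 = N - k + 2 by ring, show (N : ℤ) - k - 2 + 1 = N - k - 1 by ring,
    show (N : ℤ) - k + 2 + 1 = N - k + 3 by ring]
  rw [show (N : ℤ) - k + 1 - 1 = N - k by ring, show (N : ℤ) - k + 1 + 1 = N - k + 2 by ring,
    show (N : ℤ) - k + 1 - 2 = N - k - 1 by ring, show (N : ℤ) - k + 1 + 2 = N - k + 3 by ring,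
    show (N : ℤ) - k + 1 - 3 = N - k - 2 by ring] at h2
  push_cast
  linear_combination h1 + ε * h2

/-- The alternating sign reverses the neighbours at distance 1 and keeps those at distance 2, which
turns the difference `1 - A` of the recurrence into `1 + A`. -/
theorem isPrincipalVector_of_chebWave {N : ℕ} {ε x : ℝ} (hx : x ≠ 0) {z : ℕ → ℝ}
    (hz : ∀ k, z k = (-1) ^ (k - 1) * chebWave N ε x k) (hm1 : chebWave N ε x (-1) = 0)
    (h0 : chebWave N ε x 0 = 0) (hN1 : chebWave N ε x (N + 1) = 0)
    (hN2 : chebWave N ε x (N + 2) = 0) (hne : ∃ k, 1 ≤ k ∧ k ≤ N ∧ z k ≠ 0) :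
    IsPrincipalVector N (1 / (4 * x ^ 2)) z := by
  refine isPrincipalVector_of_recurrence (fun k => (-1 : ℝ) ^ (k - 1) * chebWave N ε x k)
    (fun k hk => ?_) (by simp [hm1]) (by simp [h0]) (by simp [hN1]) (by simp [hN2]) (fun k => ?_) hne
  · simp only [hz]
    rw [← zpow_natCast, Nat.cast_sub hk, Nat.cast_one]
  · have h1 : (-1 : ℝ) ^ (k + 1 - 1) = -(-1) ^ (k - 1) := by
      rw [show k + 1 - 1 = k - 1 + 1 by ring, zpow_add₀ (by norm_num)]; norm_num
    have h2 : (-1 : ℝ) ^ (k - 1 - 1) = -(-1) ^ (k - 1) := by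
      rw [show k - 1 - 1 = k - 1 + (-1) by ring, zpow_add₀ (by norm_num)]; norm_num
    have h3 : (-1 : ℝ) ^ (k + 2 - 1) = (-1) ^ (k - 1) := by
      rw [show k + 2 - 1 = k - 1 + 2 by ring, zpow_add₀ (by norm_num)]; norm_num
    have h4 : (-1 : ℝ) ^ (k - 2 - 1) = (-1) ^ (k - 1) := by
      rw [show k - 2 - 1 = k - 1 + (-2) by ring, zpow_add₀ (by norm_num)]; norm_num
    have h := chebWave_recurrence N ε x k
    simp only [h1, h2, h3, h4]
    field_simp
    linear_combination 2 * h

/-! ### The substitution `x = sin ψ` -/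

theorem chebU_sin_mul_cos (n : ℤ) (ψ : ℝ) :
    chebU n (Real.sin ψ) * Real.cos ψ = Real.sin ((n + 1) * (Real.pi / 2 - ψ)) := by
  have := Chebyshev.U_real_cos (θ := Real.pi / 2 - ψ) n
  rwa [Real.cos_pi_div_two_sub, Real.sin_pi_div_two_sub] at this

/-- At a root of `U'_{N+1}` this becomes `(N + 3) U_N = (N + 1) U_{N+2}`, the condition that makes
the `ε = -1` wave vanish at `k = -1` and `k = N + 2`. -/
theorem two_mul_one_sub_sq_mul_derivative_U (N : ℕ) (x : ℝ) :
    2 * (1 - x ^ 2) * (derivative (Chebyshev.U ℝ ((N : ℤ) + 1))).eval x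
      = (N + 3) * chebU N x - (N + 1) * chebU (N + 2) x := by
  have h1 := congrArg (eval x) (Chebyshev.add_one_mul_T_eq_poly_in_U (R := ℝ) ((N : ℤ) + 1))
  have h2 := congrArg (eval x) (Chebyshev.two_mul_T_eq_U_sub_U ℝ (N : ℤ))
  have h3 := chebU_add_two N x
  rw [show (N : ℤ) + 1 + 1 = N + 2 by ring] at h1
  simp only [eval_mul, eval_add, eval_sub, eval_one, eval_X, eval_pow, eval_ofNat, Int.cast_add,
    Int.cast_natCast, Int.cast_one, eval_natCast] at h1 h2
  simp only [chebU] at h3 ⊢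
  linear_combination 2 * h1 - (N + 2) * h2 - h3

theorem cos_nat_sub_nat_mul_pi_sub (m k : ℕ) (a : ℝ) :
    Real.cos (m * Real.pi - k * Real.pi - a) = (-1) ^ m * (-1) ^ k * Real.cos a := by
  simp [Real.cos_sub, Real.sin_sub, Real.sin_nat_mul_pi, Real.cos_nat_mul_pi]

theorem sin_nat_sub_nat_mul_pi_add_pi_div_two_sub (m k : ℕ) (a : ℝ) :
    Real.sin (m * Real.pi - k * Real.pi + Real.pi / 2 - a) = (-1) ^ m * (-1) ^ k * Real.cos a := by
  rw [add_sub_assoc, Real.sin_add, Real.cos_pi_div_two_sub, Real.sin_pi_div_two_sub]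
  simp [Real.cos_sub, Real.sin_sub, Real.sin_nat_mul_pi, Real.cos_nat_mul_pi]

theorem neg_one_pow_mul_self (m : ℕ) : ((-1 : ℝ) ^ m) * (-1) ^ m = 1 := by
  rw [← mul_pow]; simp

/-! ### Odd `N` -/

theorem sin_pi_div_bounds {a : ℝ} (ha : 1 < a) :
    0 < Real.pi / (2 * a) ∧ Real.pi / (2 * a) < Real.pi / 2 := by
  have := Real.pi_pos
  refine ⟨by positivity, ?_⟩
  rw [div_lt_div_iff₀ (by positivity) (by norm_num)]
  nlinarith

/-- For odd `N`, `U_{N+1}(sin t) cos t = ± cos((N + 2)t)`, whose first positive zero is at `(N + 2)t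
= π/2`. -/
theorem isLeast_chebU_root {N : ℕ} (hN : Odd N) :
    IsLeast {x : ℝ | 0 < x ∧ chebU (N + 1) x = 0} (Real.sin (Real.pi / (2 * ((N : ℝ) + 2)))) := by
  obtain ⟨m, rfl⟩ := hN
  have hpi := Real.pi_pos
  obtain ⟨hb1, hb2⟩ := sin_pi_div_bounds (a := ((2 * m + 1 : ℕ) : ℝ) + 2) (by push_cast; linarith [(Nat.cast_nonneg m : (0:ℝ) ≤ m)])
  set ψ := Real.pi / (2 * (((2 * m + 1 : ℕ) : ℝ) + 2)) with hψ
  have hψm : (2 * (m : ℝ) + 3) * ψ = Real.pi / 2 := by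
    rw [hψ]; push_cast; field_simp; ring
  have key : ∀ t, chebU ((2 * m + 1 : ℕ) + 1) (Real.sin t) * Real.cos t
      = (-1) ^ (m + 1) * Real.cos ((2 * m + 3) * t) := by
    intro t
    rw [chebU_sin_mul_cos]
    have := sin_nat_sub_nat_mul_pi_add_pi_div_two_sub (m + 1) 0 ((2 * m + 3) * t)
    rw [pow_zero, mul_one] at this
    rw [← this]; congr 1; push_cast; ring
  refine ⟨⟨Real.sin_pos_of_pos_of_lt_pi hb1 (by linarith), ?_⟩, fun x hx => ?_⟩
  · have := key ψ
    rw [hψm, Real.cos_pi_div_two, mul_zero] at this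
    exact (mul_eq_zero.mp this).resolve_right (Real.cos_pos_of_mem_Ioo ⟨by linarith, hb2⟩).ne'
  · by_contra! hlt
    have h1 : Real.arcsin x < ψ :=
      (Real.arcsin_lt_iff_lt_sin' ⟨by linarith, hb2.le⟩).mpr hlt
    have h0 : 0 < Real.arcsin x := Real.arcsin_pos.mpr hx.1
    have h2 := key (Real.arcsin x)
    rw [Real.sin_arcsin (by linarith [hx.1]) (hlt.le.trans (Real.sin_le_one _)), hx.2, zero_mul] at h2
    have h3 : 0 < Real.cos ((2 * m + 3) * Real.arcsin x) := by
      refine Real.cos_pos_of_mem_Ioo ⟨by nlinarith [(Nat.cast_nonneg m : (0:ℝ) ≤ m)], ?_⟩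
      rw [← hψm]
      exact mul_lt_mul_of_pos_left h1 (by positivity)
    have h4 : (-1 : ℝ) ^ (m + 1) ≠ 0 := pow_ne_zero _ (by norm_num)
    exact (mul_ne_zero h4 h3.ne') h2.symm

theorem sin_mul_sin_eq (a b : ℝ) :
    Real.sin a * Real.sin b = (Real.cos (a - b) - Real.cos (a + b)) / 2 := by
  rw [Real.cos_sub, Real.cos_add]; ring

theorem cos_sq_mul_chebWave (N : ℕ) (ε ψ : ℝ) (k : ℤ) :
    Real.cos ψ ^ 2 * chebWave N ε (Real.sin ψ) k
      = Real.sin (k * (Real.pi / 2 - ψ)) * Real.sin ((k + 1) * (Real.pi / 2 - ψ))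
        + ε * (Real.sin ((N - k + 1) * (Real.pi / 2 - ψ)) * Real.sin ((N - k + 2) * (Real.pi / 2 - ψ)))
        + ((N : ℝ) + 1 - 2 * k) / ((N : ℝ) + 1)
          * (Real.sin ((N + 1) * (Real.pi / 2 - ψ)) * Real.sin ((N + 2) * (Real.pi / 2 - ψ))) := by
  have h1 := chebU_sin_mul_cos (k - 1) ψ
  have h2 := chebU_sin_mul_cos k ψ
  have h3 := chebU_sin_mul_cos (N - k) ψ
  have h4 := chebU_sin_mul_cos (N - k + 1) ψ
  have h5 := chebU_sin_mul_cos N ψ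
  have h6 := chebU_sin_mul_cos (N + 1) ψ
  push_cast at h1 h2 h3 h4 h5 h6
  rw [sub_add_cancel] at h1
  rw [show (N : ℝ) - k + 1 + 1 = N - k + 2 by ring] at h4
  rw [show (N : ℝ) + 1 + 1 = N + 2 by ring] at h6
  rw [← h1, ← h2, ← h3, ← h4, ← h5, ← h6, chebWave]
  ring

theorem cos_sq_mul_zMu {m k : ℕ} (hk : 1 ≤ k) {ψ : ℝ}
    (hψ : (2 * (m : ℝ) + 3) * ψ = Real.pi / 2) :
    Real.cos ψ ^ 2 * zMu (2 * m + 1) (Real.sin ψ) k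
      = Real.cos ((2 * m + 2 - 2 * k) * ψ) - (-1) ^ k * Real.sin ψ := by
  have hw := cos_sq_mul_chebWave (2 * m + 1) 1 ψ k
  push_cast at hw
  have h1 : Real.sin ((2 * m + 1 + 2) * (Real.pi / 2 - ψ)) = 0 := by
    rw [show (2 * (m : ℝ) + 1 + 2) * (Real.pi / 2 - ψ) = ((m + 1 : ℕ) : ℝ) * Real.pi by
      push_cast; linear_combination -hψ]
    exact Real.sin_nat_mul_pi _
  have h2 : Real.cos ((2 * m + 1 + 2) * (Real.pi / 2 - ψ)) = (-1) ^ (m + 1) := by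
    rw [show (2 * (m : ℝ) + 1 + 2) * (Real.pi / 2 - ψ) = ((m + 1 : ℕ) : ℝ) * Real.pi by
      push_cast; linear_combination -hψ]
    exact Real.cos_nat_mul_pi _
  have h3 := cos_nat_sub_nat_mul_pi_sub (m + 1) k ((2 * m + 2 - 2 * k) * ψ)
  rw [show ((m + 1 : ℕ) : ℝ) * Real.pi - k * Real.pi - (2 * m + 2 - 2 * k) * ψ
    = (2 * m + 2 - 2 * k) * (Real.pi / 2 - ψ) by push_cast; ring] at h3
  have h4 : Real.cos (-(Real.pi / 2 - ψ)) = Real.sin ψ := by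
    rw [Real.cos_neg, Real.cos_pi_div_two_sub]
  have h5 := Real.cos_add ((2 * m + 1 + 2) * (Real.pi / 2 - ψ)) ((2 * m + 2 - 2 * k) * (Real.pi / 2 - ψ))
  have h6 := Real.cos_sub ((2 * m + 1 + 2) * (Real.pi / 2 - ψ)) ((2 * m + 2 - 2 * k) * (Real.pi / 2 - ψ))
  rw [h1, sin_mul_sin_eq, sin_mul_sin_eq, mul_zero, mul_zero, add_zero] at hw
  rw [show (k : ℝ) * (Real.pi / 2 - ψ) - (k + 1) * (Real.pi / 2 - ψ) = -(Real.pi / 2 - ψ) by ring,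
    show (2 * (m : ℝ) + 1 - k + 1) * (Real.pi / 2 - ψ) - (2 * m + 1 - k + 2) * (Real.pi / 2 - ψ)
      = -(Real.pi / 2 - ψ) by ring,
    show (k : ℝ) * (Real.pi / 2 - ψ) + (k + 1) * (Real.pi / 2 - ψ)
      = (2 * m + 1 + 2) * (Real.pi / 2 - ψ) - (2 * m + 2 - 2 * k) * (Real.pi / 2 - ψ) by ring,
    show (2 * (m : ℝ) + 1 - k + 1) * (Real.pi / 2 - ψ) + (2 * m + 1 - k + 2) * (Real.pi / 2 - ψ)
      = (2 * m + 1 + 2) * (Real.pi / 2 - ψ) + (2 * m + 2 - 2 * k) * (Real.pi / 2 - ψ) by ring,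
    h4, h5, h6, h1, h2, h3] at hw
  have h7 := neg_one_pow_mul_self (m + 1)
  have h8 := neg_one_pow_mul_self k
  have h9 : (-1 : ℝ) ^ (k - 1) = -(-1) ^ k := by
    obtain ⟨l, rfl⟩ := Nat.exists_eq_add_of_le' hk
    rw [Nat.add_sub_cancel, pow_succ]; ring
  rw [zMu_eq_chebWave, h9]
  linear_combination -(-1) ^ k * hw + (-1) ^ k * (-1) ^ k * Real.cos ((2 * m + 2 - 2 * k) * ψ) * h7
    + Real.cos ((2 * m + 2 - 2 * k) * ψ) * h8

/-- Here `sin ψ = cos((N + 1)ψ)` because `(N + 2)ψ = π/2`, and this is less than `cos((N + 1 -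
2k)ψ)` because `|N + 1 - 2k| < N + 1`. -/
theorem zMu_pos {N : ℕ} (hN : Odd N) {k : ℕ} (hk : 1 ≤ k) (hkN : k ≤ N) :
    0 < zMu N (Real.sin (Real.pi / (2 * ((N : ℝ) + 2)))) k := by
  obtain ⟨m, rfl⟩ := hN
  obtain ⟨hb1, hb2⟩ := sin_pi_div_bounds (a := ((2 * m + 1 : ℕ) : ℝ) + 2)
    (by push_cast; linarith [(Nat.cast_nonneg m : (0 : ℝ) ≤ m)])
  set ψ := Real.pi / (2 * (((2 * m + 1 : ℕ) : ℝ) + 2)) with hψ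
  have hψm : (2 * (m : ℝ) + 3) * ψ = Real.pi / 2 := by
    rw [hψ]; push_cast; field_simp; ring
  have hcos : 0 < Real.cos ψ := Real.cos_pos_of_mem_Ioo ⟨by linarith, hb2⟩
  have hsin : 0 < Real.sin ψ := Real.sin_pos_of_pos_of_lt_pi hb1 (by linarith)
  have hlt : Real.sin ψ < Real.cos ((2 * m + 2 - 2 * k) * ψ) := by
    rw [← Real.cos_pi_div_two_sub, ← Real.cos_abs ((2 * m + 2 - 2 * k) * ψ)]
    have h1 : (1 : ℝ) ≤ k := by exact_mod_cast hk
    have h2 : (k : ℝ) ≤ 2 * m + 1 := by exact_mod_cast hkN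
    have h3 : |(2 * (m : ℝ) + 2 - 2 * k)| < 2 * m + 2 := by
      rw [abs_lt]; constructor <;> linarith
    refine Real.cos_lt_cos_of_nonneg_of_le_pi (abs_nonneg _) (by linarith) ?_
    rw [abs_mul, abs_of_pos hb1]
    nlinarith
  have h := cos_sq_mul_zMu (m := m) hk hψm
  have hpos : 0 < Real.cos ψ ^ 2 * zMu (2 * m + 1) (Real.sin ψ) k := by
    rw [h]
    rcases neg_one_pow_eq_or ℝ k with h' | h' <;> rw [h'] <;> linarith
  exact (mul_pos_iff_of_pos_left (by positivity)).mp hpos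

/-- At a root of `U_{N+1}` the affine term drops out, and at each of the four boundary indices both
products contain `U_{-1}` or `U_{N+1}`. -/
theorem isPrincipalVector_zMu {N : ℕ} {x : ℝ} (hx : x ≠ 0) (hroot : chebU (N + 1) x = 0)
    (hne : ∃ k, 1 ≤ k ∧ k ≤ N ∧ zMu N x k ≠ 0) :
    IsPrincipalVector N (1 / (4 * x ^ 2)) (zMu N x) := by
  refine isPrincipalVector_of_chebWave hx (zMu_eq_chebWave N x) ?_ ?_ ?_ ?_ hne <;>
    simp only [chebWave, hroot, mul_zero, add_zero]
  · norm_num [chebU_neg_one, hroot]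
  · norm_num [chebU_neg_one, hroot]
  · norm_num [chebU_neg_one, hroot]
  · rw [show (N : ℤ) + 2 - 1 = N + 1 by ring, hroot, show (N : ℤ) - (N + 2) + 1 = -1 by ring,
      chebU_neg_one]
    ring

/-! ### The principal vector at a root of `U'_{N+1}` -/

theorem sin_combination_eq_zero {N : ℕ} {ψ : ℝ}
    (h : (N + 3) * chebU N (Real.sin ψ) = (N + 1) * chebU (N + 2) (Real.sin ψ)) :
    (N + 3) * Real.sin ((N + 1) * (Real.pi / 2 - ψ))
      = (N + 1) * Real.sin ((N + 3) * (Real.pi / 2 - ψ)) := by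
  have h1 := chebU_sin_mul_cos N ψ
  have h2 := chebU_sin_mul_cos (N + 2) ψ
  push_cast at h1 h2
  rw [show (N : ℝ) + 2 + 1 = N + 3 by ring] at h2
  rw [← h1, ← h2]
  linear_combination Real.cos ψ * h

/-- Guarantees that the factor common to all coordinates in `cos_sq_mul_chebWave_neg` is nonzero. -/
theorem sin_add_two_ne_zero {N : ℕ} {φ : ℝ} (hφ : Real.sin φ ≠ 0)
    (h : (N + 3) * Real.sin ((N + 1) * φ) = (N + 1) * Real.sin ((N + 3) * φ)) :
    Real.sin ((N + 2) * φ) ≠ 0 := by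
  intro h0
  have h1 : Real.sin ((N + 1) * φ) = -(Real.cos ((N + 2) * φ) * Real.sin φ) := by
    rw [show ((N : ℝ) + 1) * φ = (N + 2) * φ - φ by ring, Real.sin_sub, h0]; ring
  have h3 : Real.sin ((N + 3) * φ) = Real.cos ((N + 2) * φ) * Real.sin φ := by
    rw [show ((N : ℝ) + 3) * φ = (N + 2) * φ + φ by ring, Real.sin_add, h0]; ring
  rw [h1, h3] at h
  have h4 : (2 * (N : ℝ) + 4) * (Real.cos ((N + 2) * φ) * Real.sin φ) = 0 := by
    linear_combination -h
  have h5 : Real.cos ((N + 2) * φ) ≠ 0 := by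
    intro h5
    have := Real.sin_sq_add_cos_sq ((N + 2) * φ)
    rw [h0, h5] at this
    norm_num at this
  exact mul_ne_zero (by positivity) (mul_ne_zero h5 hφ) h4

theorem cos_sq_mul_chebWave_neg (N : ℕ) (ψ : ℝ) (k : ℤ) :
    Real.cos ψ ^ 2 * chebWave N (-1) (Real.sin ψ) k
      = -Real.sin ((N + 2) * (Real.pi / 2 - ψ)) * (Real.sin ((N + 1 - 2 * k) * (Real.pi / 2 - ψ))
        - ((N : ℝ) + 1 - 2 * k) / ((N : ℝ) + 1) * Real.sin ((N + 1) * (Real.pi / 2 - ψ))) := by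
  rw [cos_sq_mul_chebWave]
  set φ := Real.pi / 2 - ψ
  have h1 := sin_mul_sin_eq (k * φ) ((k + 1) * φ)
  have h2 := sin_mul_sin_eq ((N - k + 1) * φ) ((N - k + 2) * φ)
  have h3 := sin_mul_sin_eq ((N + 2) * φ) ((N + 1 - 2 * k) * φ)
  rw [show (k : ℝ) * φ - (k + 1) * φ = -φ by ring,
    show (k : ℝ) * φ + (k + 1) * φ = (2 * k + 1) * φ by ring] at h1
  rw [show ((N : ℝ) - k + 1) * φ - (N - k + 2) * φ = -φ by ring,
    show ((N : ℝ) - k + 1) * φ + (N - k + 2) * φ = (2 * N - 2 * k + 3) * φ by ring] at h2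
  rw [show ((N : ℝ) + 2) * φ - (N + 1 - 2 * k) * φ = (2 * k + 1) * φ by ring,
    show ((N : ℝ) + 2) * φ + (N + 1 - 2 * k) * φ = (2 * N - 2 * k + 3) * φ by ring] at h3
  linear_combination h1 - h2 + h3

/-- A zero first coordinate would be a second linear relation for `sin((N + 1)φ)` and `cos((N +
1)φ)`, `φ = π/2 - ψ`; together with the root condition it would force both to vanish. -/
theorem chebWave_neg_one_ne_zero {N : ℕ} {ψ : ℝ} (hs : Real.sin ψ ≠ 0) (hc : Real.cos ψ ≠ 0)
    (h : (N + 3) * chebU N (Real.sin ψ) = (N + 1) * chebU (N + 2) (Real.sin ψ)) :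
    chebWave N (-1) (Real.sin ψ) 1 ≠ 0 := by
  intro h0
  have h1 := cos_sq_mul_chebWave_neg N ψ 1
  have hsφ : Real.sin (Real.pi / 2 - ψ) = Real.cos ψ := Real.sin_pi_div_two_sub ψ
  have hcφ : Real.cos (Real.pi / 2 - ψ) = Real.sin ψ := Real.cos_pi_div_two_sub ψ
  have h2 := sin_combination_eq_zero h
  set φ := Real.pi / 2 - ψ
  have hN2 : Real.sin ((N + 2) * φ) ≠ 0 := sin_add_two_ne_zero (by rwa [hsφ]) h2
  rw [h0, mul_zero, eq_comm, neg_mul, neg_eq_zero] at h1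
  have h3 := (mul_eq_zero.mp h1).resolve_left hN2
  have hNpos : (0 : ℝ) < N + 1 := by positivity
  push_cast at h3
  rw [show ((N : ℝ) + 1 - 2 * 1) * φ = (N + 1) * φ - 2 * φ by ring] at h3
  rw [show ((N : ℝ) + 3) * φ = (N + 1) * φ + 2 * φ by ring] at h2
  have h4 : ((N : ℝ) + 1) * Real.sin ((N + 1) * φ - 2 * φ)
      = (N - 1) * Real.sin ((N + 1) * φ) := by
    rw [sub_eq_zero.mp h3]
    field_simp
    ring
  rw [Real.sin_sub] at h4
  rw [Real.sin_add] at h2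
  have h5 : Real.sin ((N + 1) * φ) * (1 - Real.cos (2 * φ)) = 0 := by
    have : ((N : ℝ) + 1) * (Real.sin ((N + 1) * φ) * (1 - Real.cos (2 * φ))) = 0 := by
      linear_combination (1 / 2) * h2 - (1 / 2) * h4
    exact (mul_eq_zero.mp this).resolve_left hNpos.ne'
  have h6 : 1 - Real.cos (2 * φ) ≠ 0 := by
    rw [Real.cos_two_mul, hcφ]
    have := Real.sin_sq_add_cos_sq ψ
    have h7 : 0 < Real.cos ψ ^ 2 := by positivity
    intro h8; nlinarith
  have h7 := (mul_eq_zero.mp h5).resolve_right h6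
  rw [h7] at h2
  have h8 : ((N : ℝ) + 1) * (Real.cos ((N + 1) * φ) * Real.sin (2 * φ)) = 0 := by
    linear_combination -h2
  have h9 : Real.sin (2 * φ) ≠ 0 := by
    rw [Real.sin_two_mul, hsφ, hcφ]
    exact mul_ne_zero (mul_ne_zero two_ne_zero hc) hs
  have h10 := (mul_eq_zero.mp ((mul_eq_zero.mp h8).resolve_left hNpos.ne')).resolve_right h9
  have := Real.sin_sq_add_cos_sq ((N + 1) * φ)
  rw [h7, h10] at this
  norm_num at this

theorem isPrincipalVector_zNu {N : ℕ} (hN : 1 ≤ N) {ψ : ℝ} (hs : Real.sin ψ ≠ 0)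
    (hc : Real.cos ψ ≠ 0)
    (h : (N + 3) * chebU N (Real.sin ψ) = (N + 1) * chebU (N + 2) (Real.sin ψ)) :
    IsPrincipalVector N (1 / (4 * Real.sin ψ ^ 2)) (zNu N (Real.sin ψ)) := by
  have hNpos : ((N : ℝ) + 1) ≠ 0 := by positivity
  refine isPrincipalVector_of_chebWave hs (zNu_eq_chebWave N _) ?_ ?_ ?_ ?_
    ⟨1, le_rfl, hN, ?_⟩
  · simp only [chebWave]
    rw [show (N : ℤ) - -1 = N + 1 by ring, show (N : ℤ) + 1 + 1 = N + 2 by ring, chebU_neg_one]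
    push_cast
    field_simp
    linear_combination chebU (N + 1) (Real.sin ψ) * h
  · simp only [chebWave]
    rw [show (0 : ℤ) - 1 = -1 by ring, sub_zero, chebU_neg_one]
    push_cast
    field_simp
    ring
  · simp only [chebWave]
    rw [show (N : ℤ) + 1 - 1 = N by ring, show (N : ℤ) - (N + 1) = -1 by ring, chebU_neg_one]
    push_cast
    field_simp
    ring
  · simp only [chebWave]
    rw [show (N : ℤ) + 2 - 1 = N + 1 by ring, show (N : ℤ) - (N + 2) + 1 = -1 by ring,
      chebU_neg_one]
    push_cast
    field_simp
    linear_combination -chebU (N + 1) (Real.sin ψ) * h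
  · rw [zNu_eq_chebWave]
    simpa using chebWave_neg_one_ne_zero hs hc h

/-! ### Even `N` -/

theorem sin_two_mul_add_one_mul (m : ℕ) (ψ : ℝ) :
    Real.sin ((2 * m + 1) * (Real.pi / 2 - ψ)) = (-1) ^ m * Real.cos ((2 * m + 1) * ψ) := by
  have := sin_nat_sub_nat_mul_pi_add_pi_div_two_sub m 0 ((2 * m + 1) * ψ)
  rw [pow_zero, mul_one] at this
  rw [← this]; congr 1; push_cast; ring

theorem cos_sq_mul_zNu {m k : ℕ} (hk : 1 ≤ k) (ψ : ℝ) :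
    Real.cos ψ ^ 2 * zNu (2 * m) (Real.sin ψ) k
      = (-1) ^ m * Real.sin ((2 * m + 2) * (Real.pi / 2 - ψ)) *
        (Real.cos ((2 * m + 1 - 2 * k) * ψ)
          - (-1) ^ k * ((2 * m + 1 - 2 * k) / (2 * m + 1)) * Real.cos ((2 * m + 1) * ψ)) := by
  have hw := cos_sq_mul_chebWave_neg (2 * m) ψ k
  push_cast at hw
  have h1 := sin_nat_sub_nat_mul_pi_add_pi_div_two_sub m k ((2 * m + 1 - 2 * k) * ψ)
  rw [show (m : ℝ) * Real.pi - k * Real.pi + Real.pi / 2 - (2 * m + 1 - 2 * k) * ψ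
    = (2 * m + 1 - 2 * k) * (Real.pi / 2 - ψ) by ring] at h1
  rw [h1, sin_two_mul_add_one_mul] at hw
  have h8 := neg_one_pow_mul_self k
  have h9 : (-1 : ℝ) ^ (k - 1) = -(-1) ^ k := by
    obtain ⟨l, rfl⟩ := Nat.exists_eq_add_of_le' hk
    rw [Nat.add_sub_cancel, pow_succ]; ring
  rw [zNu_eq_chebWave, h9]
  linear_combination -(-1) ^ k * hw + (-1) ^ m * Real.sin ((2 * m + 2) * (Real.pi / 2 - ψ)) *
    Real.cos ((2 * m + 1 - 2 * k) * ψ) * h8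

/-- Only the factor independent of `k` has unknown sign, and it is squared in the product. The
bracket is positive: `cos((N + 1)ψ) ≥ 0` has a coefficient of modulus at most 1 and is less than
`cos((N + 1 - 2k)ψ)`. -/
theorem zNu_mul_pos {m : ℕ} {ψ : ℝ} (hψ0 : 0 < ψ) (hψ1 : (2 * m + 1) * ψ ≤ Real.pi / 2)
    (hc : 0 < Real.cos ψ) (hne : Real.sin ((2 * m + 2) * (Real.pi / 2 - ψ)) ≠ 0) {i j : ℕ}
    (hi : i ∈ Finset.Icc 1 (2 * m)) (hj : j ∈ Finset.Icc 1 (2 * m)) :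
    0 < zNu (2 * m) (Real.sin ψ) i * zNu (2 * m) (Real.sin ψ) j := by
  have hbr : ∀ k ∈ Finset.Icc 1 (2 * m), 0 < Real.cos ((2 * m + 1 - 2 * k) * ψ)
      - (-1) ^ k * ((2 * m + 1 - 2 * k) / (2 * m + 1)) * Real.cos ((2 * m + 1) * ψ) := by
    intro k hk
    obtain ⟨hk1, hk2⟩ := Finset.mem_Icc.mp hk
    have h1 : (1 : ℝ) ≤ k := by exact_mod_cast hk1
    have h2 : (k : ℝ) ≤ 2 * m := by exact_mod_cast hk2
    have hm : (0 : ℝ) < 2 * m + 1 := by positivity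
    have h3 : |(2 * (m : ℝ) + 1 - 2 * k)| < 2 * m + 1 := by
      rw [abs_lt]; constructor <;> linarith
    have hpi := Real.pi_pos
    have hlt : Real.cos ((2 * m + 1) * ψ) < Real.cos ((2 * m + 1 - 2 * k) * ψ) := by
      rw [← Real.cos_abs ((2 * m + 1 - 2 * k) * ψ)]
      refine Real.cos_lt_cos_of_nonneg_of_le_pi (abs_nonneg _) (by linarith) ?_
      rw [abs_mul, abs_of_pos hψ0]
      exact mul_lt_mul_of_pos_right h3 hψ0
    have hnn : 0 ≤ Real.cos ((2 * m + 1) * ψ) :=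
      Real.cos_nonneg_of_mem_Icc ⟨by nlinarith, hψ1⟩
    have h4 : |(-1 : ℝ) ^ k * ((2 * m + 1 - 2 * k) / (2 * m + 1))| ≤ 1 := by
      rw [abs_mul, abs_neg_one_pow, one_mul, abs_div, abs_of_pos hm]
      exact (div_le_one hm).mpr h3.le
    have h5 := mul_le_mul_of_nonneg_right ((le_abs_self _).trans h4) hnn
    linarith
  have hpi := cos_sq_mul_zNu (m := m) (Finset.mem_Icc.mp hi).1 ψ
  have hpj := cos_sq_mul_zNu (m := m) (Finset.mem_Icc.mp hj).1 ψ
  have h : Real.cos ψ ^ 4 * (zNu (2 * m) (Real.sin ψ) i * zNu (2 * m) (Real.sin ψ) j)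
      = (Real.cos ψ ^ 2 * zNu (2 * m) (Real.sin ψ) i)
        * (Real.cos ψ ^ 2 * zNu (2 * m) (Real.sin ψ) j) := by ring
  have hpos : 0 < Real.cos ψ ^ 4 * (zNu (2 * m) (Real.sin ψ) i * zNu (2 * m) (Real.sin ψ) j) := by
    rw [h, hpi, hpj, mul_mul_mul_comm]
    refine mul_pos ?_ (mul_pos (hbr i hi) (hbr j hj))
    exact mul_self_pos.mpr (mul_ne_zero (pow_ne_zero _ (by norm_num)) hne)
  exact (mul_pos_iff_of_pos_left (by positivity)).mp hpos

/-- Rolle's theorem between the zeros `cos 2θ` and `cos θ` of `U_{N+1}`, `θ = π/(N + 2)`; `N ≥ 2`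
makes `cos 2θ ≥ 0`. -/
theorem exists_derivative_chebU_root {N : ℕ} (hN : 2 ≤ N) :
    ∃ x : ℝ, 0 < x ∧ x < 1 ∧ (derivative (Chebyshev.U ℝ ((N : ℤ) + 1))).eval x = 0 := by
  have hpi := Real.pi_pos
  have hN' : (2 : ℝ) ≤ N := by exact_mod_cast hN
  set θ := Real.pi / (N + 2) with hθ
  have hθN : (N + 2) * θ = Real.pi := by rw [hθ]; field_simp
  have hθ0 : 0 < θ := by positivity
  have h2θ : 2 * θ ≤ Real.pi / 2 := by nlinarith
  have hlt : Real.cos (2 * θ) < Real.cos θ :=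
    Real.cos_lt_cos_of_nonneg_of_le_pi hθ0.le (by linarith) (by linarith)
  have hzero : ∀ j : ℕ, 0 < j * θ → j * θ < Real.pi →
      (Chebyshev.U ℝ ((N : ℤ) + 1)).eval (Real.cos (j * θ)) = 0 := by
    intro j h1 h2
    have h := Chebyshev.U_real_cos (θ := j * θ) ((N : ℤ) + 1)
    push_cast at h
    rw [show ((N : ℝ) + 1 + 1) * (j * θ) = j * ((N + 2) * θ) by ring, hθN, Real.sin_nat_mul_pi] at h
    exact (mul_eq_zero.mp h).resolve_right (Real.sin_pos_of_pos_of_lt_pi h1 h2).ne'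
  have h1 := hzero 1 (by simpa using hθ0) (by push_cast; linarith)
  have h2 := hzero 2 (by push_cast; linarith) (by push_cast; linarith)
  push_cast at h1 h2
  rw [one_mul] at h1
  obtain ⟨x, hx, hx'⟩ := exists_hasDerivAt_eq_zero hlt
    (Polynomial.continuous _).continuousOn (h2.trans h1.symm)
    fun x _ => (Chebyshev.U ℝ ((N : ℤ) + 1)).hasDerivAt x
  exact ⟨x, (Real.cos_nonneg_of_mem_Icc ⟨by linarith, h2θ⟩).trans_lt hx.1,
    hx.2.trans_le (Real.cos_le_one _), hx'⟩

/-- Supplies the bound `(N + 1)ψ ≤ π/2` needed for the signs, since `U'_{N+1}` has opposite signs at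
`0` and at `sin(π/(2(N + 1)))`. -/
theorem exists_derivative_chebU_root_of_even {m : ℕ} (hm : 1 ≤ m) :
    ∃ x : ℝ, 0 < x ∧ x < Real.sin (Real.pi / (2 * (2 * m + 1))) ∧
      (derivative (Chebyshev.U ℝ (((2 * m : ℕ) : ℤ) + 1))).eval x = 0 := by
  have hpi := Real.pi_pos
  have hm' : (1 : ℝ) ≤ m := by exact_mod_cast hm
  obtain ⟨hb1, hb2⟩ := sin_pi_div_bounds (a := 2 * (m : ℝ) + 1) (by linarith)
  set ψ := Real.pi / (2 * (2 * (m : ℝ) + 1)) with hψ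
  have hψm : (2 * (m : ℝ) + 1) * ψ = Real.pi / 2 := by rw [hψ]; field_simp
  set p := derivative (Chebyshev.U ℝ (((2 * m : ℕ) : ℤ) + 1)) with hp
  have key : ∀ t, 2 * Real.cos t ^ 3 * ((-1) ^ m * p.eval (Real.sin t))
      = (2 * m + 3) * Real.cos ((2 * m + 1) * t) + (2 * m + 1) * Real.cos ((2 * m + 3) * t) := by
    intro t
    have h1 := two_mul_one_sub_sq_mul_derivative_U (2 * m) (Real.sin t)
    rw [← hp, ← Real.cos_sq'] at h1
    have h2 := chebU_sin_mul_cos ((2 * m : ℕ) : ℤ) t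
    have h3 := chebU_sin_mul_cos (((2 * m : ℕ) : ℤ) + 2) t
    have h4 := sin_two_mul_add_one_mul m t
    have h5 := sin_two_mul_add_one_mul (m + 1) t
    push_cast at h1 h2 h3 h4 h5
    rw [h4] at h2
    rw [show 2 * ((m : ℝ) + 1) + 1 = 2 * m + 3 by ring] at h5
    rw [show 2 * (m : ℝ) + 2 + 1 = 2 * m + 3 by ring, h5, pow_succ] at h3
    have h6 := neg_one_pow_mul_self m
    linear_combination (-1) ^ m * Real.cos t * h1 + (-1) ^ m * (2 * m + 3) * h2
      - (-1) ^ m * (2 * m + 1) * h3 + ((2 * m + 3) * Real.cos ((2 * m + 1) * t)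
      + (2 * m + 1) * Real.cos ((2 * m + 3) * t)) * h6
  have h0 : 0 < (-1) ^ m * p.eval 0 := by
    have := key 0
    simp only [Real.cos_zero, Real.sin_zero, mul_zero, one_pow, mul_one] at this
    linarith
  have h1 : (-1) ^ m * p.eval (Real.sin ψ) < 0 := by
    have h := key ψ
    rw [hψm, Real.cos_pi_div_two, mul_zero, zero_add] at h
    -- The angle is `π/2 + 2ψ`, strictly between `π/2` and `3π/2`.
    have h2 : Real.cos ((2 * m + 3) * ψ) < 0 :=
      Real.cos_neg_of_pi_div_two_lt_of_lt (by nlinarith) (by nlinarith)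
    have h3 : 0 < Real.cos ψ := Real.cos_pos_of_mem_Ioo ⟨by linarith, hb2⟩
    by_contra! hcon
    have h4 : 0 ≤ 2 * Real.cos ψ ^ 3 * ((-1) ^ m * p.eval (Real.sin ψ)) := by positivity
    have h5 : (2 * (m : ℝ) + 1) * Real.cos ((2 * m + 3) * ψ) < 0 :=
      mul_neg_of_pos_of_neg (by positivity) h2
    linarith
  have hsin : 0 < Real.sin ψ := Real.sin_pos_of_pos_of_lt_pi hb1 (by linarith)
  obtain ⟨x, hx, hx'⟩ := intermediate_value_Ioo' hsin.le
    (f := fun x => (-1) ^ m * p.eval x) (by fun_prop) ⟨h1, h0⟩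
  exact ⟨x, hx.1, hx.2, (mul_eq_zero.mp hx').resolve_left (pow_ne_zero _ (by norm_num))⟩

theorem exists_isLeast_pos_root {p : ℝ[X]} (hp : p ≠ 0) (h : ∃ x, 0 < x ∧ p.eval x = 0) :
    ∃ x, IsLeast {x : ℝ | 0 < x ∧ p.eval x = 0} x := by
  have hfin : {x : ℝ | 0 < x ∧ p.eval x = 0}.Finite :=
    p.roots.toFinset.finite_toSet.subset fun x hx => by simpa [hp] using hx.2
  obtain ⟨x, hx, hmin⟩ := Set.exists_min_image _ id hfin h
  exact ⟨x, hx, hmin⟩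

/-! ### Assembly of the two cases -/

theorem theorem4p1 (N : ℕ) (hN : 1 ≤ N) :
    -- the case of odd `N`
    (Odd N → ∀ μ : ℝ, μ = Real.sin (Real.pi / (2 * ((N : ℝ) + 2))) →
      IsLeast {x : ℝ | 0 < x ∧ chebU (N + 1) x = 0} μ ∧
      IsPrincipalVector N (1 / (4 * μ ^ 2)) (zMu N μ) ∧
      0 < denom N (zMu N μ) ∧
      (∃! F : ℝ[X], IsExtremal N F) ∧
      ∀ F : ℝ[X], IsExtremal N F → CoeffsGivenBy N (zMu N μ) F) ∧
    -- the least positive root of the derivative, and its principal vector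
    (2 ≤ N → ∃ ν : ℝ,
      IsLeast {x : ℝ | 0 < x ∧ (derivative (Chebyshev.U ℝ ((N : ℤ) + 1))).eval x = 0} ν ∧
      IsPrincipalVector N (1 / (4 * ν ^ 2)) (zNu N ν) ∧
      -- the case of even `N`
      (Even N →
        0 < denom N (zNu N ν) ∧
        (∃! F : ℝ[X], IsExtremal N F) ∧
        ∀ F : ℝ[X], IsExtremal N F → CoeffsGivenBy N (zNu N ν) F)) := by
  constructor
  · rintro hodd μ rfl
    have hroot := isLeast_chebU_root hodd
    have hpos := fun k (hk : k ∈ Finset.Icc 1 N) =>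
      zMu_pos hodd (Finset.mem_Icc.mp hk).1 (Finset.mem_Icc.mp hk).2
    have hμ := hroot.1.1
    have hprin := isPrincipalVector_zMu hμ.ne' hroot.1.2
      ⟨1, le_rfl, hN, (hpos 1 (Finset.mem_Icc.mpr ⟨le_rfl, hN⟩)).ne'⟩
    exact ⟨hroot, hprin, extremal_of_principal_vector hN (by positivity) hprin
      fun i hi j hj => mul_pos (hpos i hi) (hpos j hj)⟩
  · intro hN2
    obtain ⟨x, hx0, hx1, hx⟩ := exists_derivative_chebU_root hN2
    have hne : derivative (Chebyshev.U ℝ ((N : ℤ) + 1)) ≠ 0 := by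
      intro h
      have h1 := Polynomial.derivative_eq_zero.mp h
      have h2 := Chebyshev.natDegree_U_natCast ℝ (N + 1)
      push_cast at h2
      omega
    obtain ⟨ν, hν⟩ := exists_isLeast_pos_root hne ⟨x, hx0, hx⟩
    have hν0 : 0 < ν := hν.1.1
    -- A root below 1 makes `ν` the sine of an angle with positive cosine.
    have hν1 : ν < 1 := (hν.2 ⟨hx0, hx⟩).trans_lt hx1
    have hsin : Real.sin (Real.arcsin ν) = ν := Real.sin_arcsin (by linarith) hν1.le
    have hψ0 : 0 < Real.arcsin ν := Real.arcsin_pos.mpr hν0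
    have hcos : 0 < Real.cos (Real.arcsin ν) := by
      rw [Real.cos_arcsin]
      exact Real.sqrt_pos.mpr (by nlinarith)
    have hcond : (N + 3) * chebU N (Real.sin (Real.arcsin ν))
        = (N + 1) * chebU (N + 2) (Real.sin (Real.arcsin ν)) := by
      have h := two_mul_one_sub_sq_mul_derivative_U N ν
      rw [hν.1.2, mul_zero] at h
      rw [hsin]; linarith
    have hprin := isPrincipalVector_zNu hN (by rw [hsin]; exact hν0.ne') hcos.ne' hcond
    rw [hsin] at hprin
    refine ⟨ν, hν, hprin, ?_⟩
    rintro ⟨m, hm⟩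
    obtain rfl : N = 2 * m := by omega
    refine extremal_of_principal_vector hN (by positivity) hprin fun i hi j hj => ?_
    obtain ⟨y, hy0, hy1, hy⟩ := exists_derivative_chebU_root_of_even (m := m) (by omega)
    have hlt : ν < Real.sin (Real.pi / (2 * (2 * m + 1))) := (hν.2 ⟨hy0, hy⟩).trans_lt hy1
    have hm1 : (1 : ℝ) ≤ m := by exact_mod_cast (by omega : 1 ≤ m)
    obtain ⟨hb1, hb2⟩ := sin_pi_div_bounds (a := 2 * (m : ℝ) + 1) (by linarith)
    have hψ1 : Real.arcsin ν < Real.pi / (2 * (2 * m + 1)) :=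
      (Real.arcsin_lt_iff_lt_sin' ⟨by linarith, hb2.le⟩).mpr hlt
    have hψ2 : (2 * (m : ℝ) + 1) * Real.arcsin ν ≤ Real.pi / 2 := by
      have := mul_le_mul_of_nonneg_left hψ1.le (by positivity : (0 : ℝ) ≤ 2 * m + 1)
      refine this.trans_eq ?_
      field_simp
    have hne2 := sin_add_two_ne_zero (N := 2 * m) (φ := Real.pi / 2 - Real.arcsin ν)
      (by rw [Real.sin_pi_div_two_sub]; exact hcos.ne') (sin_combination_eq_zero hcond)
    push_cast at hne2
    have := zNu_mul_pos hψ0 hψ2 hcos hne2 hi hj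
    rwa [hsin] at this
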